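/- Let $\mathbb D=\{z\in\mathbb C:|z|<1\}$ and let $\mathcal H_0$ be the set of analytic maps $f:\mathbb D\to\mathbb D$ with $f(0)=0$. Let $0\le s<r<1$ and $\lambda\in\mathbb C$, $|\lambda|<1$. Let $\mathcal H_0(r,s,\lambda)$ be the set of all $f\in\mathcal H_0$ with $$f(r)=s,\qquad f'(r)=\frac sr+\frac{r^2-s^2}{r(1-r^2)}\lambda ,$$ and put $V(r,s,\lambda)=\{f'''(r):f\in\mathcal H_0(r,s,\lambda)\}$. Put $$A=\frac{6(r^2-s^2)}{r^3(1-r^2)^3},\quad B=s^2\lambda^3-s(1+r^2)\lambda^2+r^2\lambda,\quad C=r(1-|\lambda|^2)(1+r^2-2s\lambda),$$ $$\eta=\frac{r\overline\lambda}{1+r^2-2s\lambda},\quad t=\frac r{|1+r^2-2s\lambda|},\quad c(\zeta)=\zeta(1-\eta\zeta),\quad \rho(\zeta)=t(1-|\zeta|^2),$$ and, for $|a|<1$, $T_a(z)=\dfrac{z+a}{1+\overline a z}$. For $\theta\in\mathbb R$ let $t_\theta$ be the solution $x$ of $$|xe^{i\theta}-\overline\eta|=2(x^2-|\eta|^2),\qquad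 x>|\eta|,$$ if $|te^{i\theta}-\overline\eta|\ge 2(t^2-|\eta|^2)$, and $t_\theta=t$ otherwise; put $$\zeta_\theta=\frac{t_\theta e^{i\theta}-\overline\eta}{2(t_\theta^2-|\eta|^2)} .$$ Then the following hold. In the case $|te^{i\theta}-\overline\eta|\ge 2(t^2-|\eta|^2)$ the above equation has exactly one solution $x>|\eta|$, and $\zeta_\theta\in\overline{\mathbb D}$ for all $\theta\in\mathbb R$. $V(r,s,\lambda)$ is a convex closed domain enclosed by the Jordan curve $\partial V(r,s,\lambda)$: it is convex and compact, it is the closure of its interior, the interior is nonempty and connected, and the boundary is a Jordan curve. There is a continuous $2\pi$-periodic function $\gamma:\mathbb R\to\mathbb C$ that maps $(-\pi,\pi]$ bijectively onto $\partial V(r,s,\lambda)$ and is given as follows. (i) If $t+|\eta|\le\frac12$, then for all $\theta\in\mathbb R$, $|te^{i\theta}-\overline\eta|\ge2(t^2-|\eta|^2)$ and $\gamma(\theta)=A(B+C\,c(\zeta_\theta))$. (ii) If $t-|\eta|\ge\frac12$, then for all $\theta\in\mathbb R$, $|te^{i\theta}-\overline\eta|\le2(t^2-|\eta|^2)$ and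 $\gamma(\theta)=A\bigl(B+C(c(\zeta_\theta)+\rho(\zeta_\theta)e^{i\theta})\bigr)$. (iii) If $t+|\eta|>\frac12$ and $t-|\eta|<\frac12$, then for all $\theta\in\mathbb R$ $$\gamma(\theta)=\begin{cases}A\bigl(B+C(c(\zeta_\theta)+\rho(\zeta_\theta)e^{i\theta})\bigr),&|te^{i\theta}-\overline\eta|<2(t^2-|\eta|^2),\\ A\bigl(B+C\,c(\zeta_\theta)\bigr),&|te^{i\theta}-\overline\eta|\ge2(t^2-|\eta|^2).\end{cases}$$ Furthermore, for every $\theta\in\mathbb R$ with $\zeta_\theta\in\mathbb D$, the point $A\bigl(B+C(c(\zeta_\theta)+\rho(\zeta_\theta)e^{i\theta})\bigr)$ lies on $\partial V(r,s,\lambda)$, and a function $f$ on $\mathbb D$ belongs to $\mathcal H_0(r,s,\lambda)$ and satisfies $f'''(r)=A\bigl(B+C(c(\zeta_\theta)+\rho(\zeta_\theta)e^{i\theta})\bigr)$ if and only if $$f(z)=z\,T_{s/r}\Bigl(T_{-r}(z)\,T_\lambda\bigl(T_{-r}(z)\,T_{\zeta_\theta}(e^{i(\theta+\arg C)}T_{-r}(z))\bigr)\Bigr),\qquad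 z\in\mathbb D;$$ this function is a Blaschke product of degree $4$. For every $\theta\in\mathbb R$ with $|\zeta_\theta|=1$, the point $A(B+C\,c(\zeta_\theta))$ lies on $\partial V(r,s,\lambda)$, and a function $f$ on $\mathbb D$ belongs to $\mathcal H_0(r,s,\lambda)$ and satisfies $f'''(r)=A(B+C\,c(\zeta_\theta))$ if and only if $$f(z)=z\,T_{s/r}\bigl(T_{-r}(z)\,T_\lambda(\zeta_\theta T_{-r}(z))\bigr),\qquad z\in\mathbb D;$$ this function is a Blaschke product of degree $3$. Here a Blaschke product of degree $n$ is a function $e^{i\varphi}\prod_{j=1}^n\frac{z-z_j}{1-\overline{z_j}z}$ with $\varphi\in\mathbb R$ and $z_1,\dots,z_n\in\mathbb D$. -/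

import Mathlib

open Set Metric Complex Topology

namespace ThirdDieudonne

open scoped ComplexConjugate

/-- The class `H₀` of analytic self-maps `f` of the open unit disk with `f 0 = 0`
(only the values of `f` on the disk matter). -/
structure MemH0 (f : ℂ → ℂ) : Prop where
  analytic : DifferentiableOn ℂ f (ball 0 1)
  mapsTo : MapsTo f (ball 0 1) (ball 0 1)
  map_zero : f 0 = 0

/-- The prescribed value `w₁ = s/r + (r² - s²)/(r(1 - r²)) λ` of the first derivative. -/
noncomputable def w₁ (r s : ℝ) (lam : ℂ) : ℂ :=
  s / r + (r ^ 2 - s ^ 2) / (r * (1 - r ^ 2)) * lam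

/-- The class of all `f ∈ H₀` with `f(r) = s` and `f'(r) = w₁(λ)`. -/
def classH0 (r s : ℝ) (lam : ℂ) : Set (ℂ → ℂ) :=
  {f | MemH0 f ∧ f r = s ∧ deriv f r = w₁ r s lam}

/-- The variability region `V(r,s,λ)` of the third derivative at `r`. -/
noncomputable def region (r s : ℝ) (lam : ℂ) : Set ℂ :=
  (fun f : ℂ → ℂ => iteratedDeriv 3 f r) '' classH0 r s lam

/-- A Jordan curve in the plane: the image of the unit circle under a continuous injection. -/
def IsJordanCurve (J : Set ℂ) : Prop :=
  ∃ g : Circle → ℂ, Continuous g ∧ Function.Injective g ∧ range g = J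

/-- `K` is a (bounded) closed domain enclosed by the Jordan curve `∂K`: `K` is compact, it is the
closure of its interior, the interior is a nonempty connected open set, and the boundary of `K` is
a Jordan curve.  (The interior of `K` is then the bounded component of the complement of `∂K`.) -/
structure IsClosedJordanDomain (K : Set ℂ) : Prop where
  isCompact : IsCompact K
  closure_interior : closure (interior K) = K
  isConnected_interior : IsConnected (interior K)
  isJordanCurve_frontier : IsJordanCurve (frontier K)

/-- The Möbius transformation `T_a(z) = (z + a)/(1 + ā z)`. -/
noncomputable def T (a z : ℂ) : ℂ := (z + a) / (1 + conj a * z)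

/-- On the open unit disk, `f` is a Blaschke product of degree `n`. -/
def IsBlaschkeProduct (n : ℕ) (f : ℂ → ℂ) : Prop :=
  ∃ (φ : ℝ) (a : Fin n → ℂ), (∀ j, ‖a j‖ < 1) ∧
    ∀ z ∈ ball (0 : ℂ) 1, f z = exp (φ * I) * ∏ j, (z - a j) / (1 - conj (a j) * z)

noncomputable def coefA (r s : ℝ) : ℝ := 6 * (r ^ 2 - s ^ 2) / (r ^ 3 * (1 - r ^ 2) ^ 3)

noncomputable def coefB (r s : ℝ) (lam : ℂ) : ℂ :=
  s ^ 2 * lam ^ 3 - s * (1 + r ^ 2) * lam ^ 2 + r ^ 2 * lam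

noncomputable def coefC (r s : ℝ) (lam : ℂ) : ℂ :=
  r * (1 - (‖lam‖ : ℂ) ^ 2) * (1 + r ^ 2 - 2 * s * lam)

noncomputable def eta (r s : ℝ) (lam : ℂ) : ℂ := r * conj lam / (1 + r ^ 2 - 2 * s * lam)

noncomputable def tpar (r s : ℝ) (lam : ℂ) : ℝ := r / ‖(1 + r ^ 2 - 2 * s * lam : ℂ)‖

/-- `c(ζ) = ζ(1 - ηζ)` -/
noncomputable def cen (η ζ : ℂ) : ℂ := ζ * (1 - η * ζ)

/-- `ρ(ζ) = t(1 - |ζ|²)` -/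
noncomputable def rad (t : ℝ) (ζ : ℂ) : ℝ := t * (1 - ‖ζ‖ ^ 2)

/-- `x` solves `|x e^{iθ} - η̄| = 2(x² - |η|²)`, `x > |η|`. -/
def IsSol (η : ℂ) (θ x : ℝ) : Prop :=
  ‖η‖ < x ∧ ‖x * exp (θ * I) - conj η‖ = 2 * (x ^ 2 - ‖η‖ ^ 2)

open Classical in
/-- `t_θ`: the solution of `|x e^{iθ} - η̄| = 2(x² - |η|²)`, `x > |η|`, if
`|t e^{iθ} - η̄| ≥ 2(t² - |η|²)`, and `t` otherwise.  (Existence and uniqueness of the solution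
are part of the theorem.) -/
noncomputable def tTheta (η : ℂ) (t θ : ℝ) : ℝ :=
  if 2 * (t ^ 2 - ‖η‖ ^ 2) ≤ ‖t * exp (θ * I) - conj η‖ then
    Classical.epsilon fun x : ℝ => IsSol η θ x
  else t

/-- `ζ_θ = (t_θ e^{iθ} - η̄) / (2(t_θ² - |η|²))` -/
noncomputable def zetaTheta (η : ℂ) (t θ : ℝ) : ℂ :=
  (tTheta η t θ * exp (θ * I) - conj η) / (2 * ((tTheta η t θ : ℂ) ^ 2 - (‖η‖ : ℂ) ^ 2))

/-- The function `z T_{s/r}(T_{-r}(z) T_λ(T_{-r}(z) T_ζ(e^{iα} T_{-r}(z))))`. -/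
noncomputable def extremal₄ (r s : ℝ) (lam ζ : ℂ) (α : ℝ) (z : ℂ) : ℂ :=
  z * T (s / r) (T (-r) z * T lam (T (-r) z * T ζ (exp (α * I) * T (-r) z)))

/-- The function `z T_{s/r}(T_{-r}(z) T_λ(ζ T_{-r}(z)))`. -/
noncomputable def extremal₃ (r s : ℝ) (lam ζ : ℂ) (z : ℂ) : ℂ :=
  z * T (s / r) (T (-r) z * T lam (ζ * T (-r) z))

end ThirdDieudonne

open ThirdDieudonne
open scoped ComplexConjugate

namespace ThirdDieudonne

/-- The union of the closed disks with centre `cen η ζ` and radius `rad t ζ`, `‖ζ‖ ≤ 1`. -/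
def diskUnion (η : ℂ) (t : ℝ) : Set ℂ :=
  {w | ∃ ζ β : ℂ, ‖β‖ ≤ 1 - ‖ζ‖ ^ 2 ∧ w = cen η ζ + t * β}

lemma norm_le_one_of_norm_le {ζ β : ℂ} (h : ‖β‖ ≤ 1 - ‖ζ‖ ^ 2) : ‖ζ‖ ≤ 1 := by
  nlinarith [norm_nonneg β, norm_nonneg ζ]

lemma isCompact_diskUnion (η : ℂ) (t : ℝ) : IsCompact (diskUnion η t) := by
  have h1 : IsCompact {p : ℂ × ℂ | ‖p.2‖ ≤ 1 - ‖p.1‖ ^ 2} := by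
    refine Metric.isCompact_of_isClosed_isBounded
      (isClosed_le (by fun_prop) (by fun_prop)) ?_
    refine (Metric.isBounded_closedBall (x := (0 : ℂ × ℂ)) (r := 1)).subset ?_
    intro p hp
    have hp' : ‖p.2‖ ≤ 1 - ‖p.1‖ ^ 2 := hp
    rw [mem_closedBall_zero_iff, Prod.norm_def]
    exact max_le (norm_le_one_of_norm_le hp') (by nlinarith [sq_nonneg ‖p.1‖])
  have h2 := h1.image (f := fun p : ℂ × ℂ => cen η p.1 + t * p.2) (by unfold cen; fun_prop)
  convert h2 using 1
  ext w
  simp only [diskUnion, mem_ofPred_eq, mem_image, Prod.exists]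
  constructor
  · rintro ⟨ζ, β, h, rfl⟩; exact ⟨ζ, β, h, rfl⟩
  · rintro ⟨ζ, β, h, rfl⟩; exact ⟨ζ, β, h, rfl⟩

lemma norm_sq_convex_combination (a b : ℝ) (hab : a + b = 1) (z w : ℂ) :
    ‖(a : ℂ) * z + b * w‖ ^ 2 = a * ‖z‖ ^ 2 + b * ‖w‖ ^ 2 - a * b * ‖z - w‖ ^ 2 := by
  obtain rfl : b = 1 - a := by linarith
  rw [Complex.sq_norm, Complex.sq_norm, Complex.sq_norm, Complex.sq_norm]
  simp only [Complex.normSq_apply, add_re, mul_re, ofReal_re, ofReal_im, add_im, mul_im, sub_re,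
    sub_im]
  ring

lemma convex_diskUnion {η : ℂ} {t : ℝ} (h : ‖η‖ < t) : Convex ℝ (diskUnion η t) := by
  rintro _ ⟨z, β, hβ, rfl⟩ _ ⟨w, δ, hδ, rfl⟩ a b ha hb hab
  have ht : 0 < t := (norm_nonneg _).trans_lt h
  have htc : (t : ℂ) ≠ 0 := by exact_mod_cast ht.ne'
  refine ⟨a * z + b * w, a * β + b * δ - a * b * (η / t) * (z - w) ^ 2, ?_, ?_⟩
  · rw [norm_sq_convex_combination a b hab]
    have h1 : ‖(a : ℂ) * β + b * δ - a * b * (η / t) * (z - w) ^ 2‖ ≤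
        a * ‖β‖ + b * ‖δ‖ + a * b * (‖η‖ / t) * ‖z - w‖ ^ 2 := by
      refine (norm_sub_le _ _).trans (add_le_add ((norm_add_le _ _).trans ?_) ?_)
      · simp [abs_of_nonneg, ha, hb]
      · simp [abs_of_nonneg, ha, hb, ht.le]
    have h2 : ‖η‖ / t ≤ 1 := (div_le_one ht).2 h.le
    have h3 : a * b * (‖η‖ / t) * ‖z - w‖ ^ 2 ≤ a * b * 1 * ‖z - w‖ ^ 2 := by gcongr
    have h4 : a * ‖β‖ ≤ a * (1 - ‖z‖ ^ 2) := by gcongr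
    have h5 : b * ‖δ‖ ≤ b * (1 - ‖w‖ ^ 2) := by gcongr
    nlinarith
  · have hb' : (b : ℂ) = 1 - a := by
      have : b = 1 - a := by linarith
      rw [this]; push_cast; ring
    simp only [cen, real_smul, hb']
    field_simp
    ring

lemma ball_subset_diskUnion {η : ℂ} {t : ℝ} (ht : 0 < t) : ball 0 t ⊆ diskUnion η t := by
  intro w hw
  have htc : (t : ℂ) ≠ 0 := by exact_mod_cast ht.ne'
  refine ⟨0, w / t, ?_, ?_⟩
  · simp only [norm_div, norm_real, Real.norm_eq_abs, abs_of_pos ht, norm_zero]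
    rw [div_le_iff₀ ht]
    simpa using (mem_ball_zero_iff.1 hw).le
  · simp [cen, mul_div_cancel₀ _ htc]

/-- `z` is a critical point of `ζ ↦ Re (ū cen η ζ) + x (1 - ‖ζ‖²)`. -/
def IsStationary (η u : ℂ) (x : ℝ) (z : ℂ) : Prop :=
  u = 2 * x * z + 2 * u * conj η * conj z

lemma IsStationary.gap_eq {η u z : ℂ} {x : ℝ} (h : IsStationary η u x z) (ζ : ℂ) :
    (conj u * cen η ζ).re + x * (1 - ‖ζ‖ ^ 2) + (x * ‖ζ - z‖ ^ 2 + (conj u * η * (ζ - z) ^ 2).re) =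
      (conj u * cen η z).re + x * (1 - ‖z‖ ^ 2) := by
  have hre := congrArg Complex.re h
  have him := congrArg Complex.im h
  simp only [add_re, add_im, mul_re, mul_im, conj_re, conj_im, ofReal_re, ofReal_im, re_ofNat,
    im_ofNat] at hre him
  rw [Complex.sq_norm, Complex.sq_norm, Complex.sq_norm]
  simp only [Complex.normSq_apply, cen, pow_two, mul_re, mul_im, conj_re, conj_im,
    sub_re, sub_im, one_re, one_im]
  linear_combination (ζ.re - z.re) * hre + (ζ.im - z.im) * him

lemma IsStationary.gap_le {η u z : ℂ} {x : ℝ} (h : IsStationary η u x z) (hu : ‖u‖ = 1) (ζ : ℂ) :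
    (conj u * cen η ζ).re + x * (1 - ‖ζ‖ ^ 2) + (x - ‖η‖) * ‖ζ - z‖ ^ 2 ≤
      (conj u * cen η z).re + x * (1 - ‖z‖ ^ 2) := by
  rw [← h.gap_eq ζ]
  have h1 : -(‖η‖ * ‖ζ - z‖ ^ 2) ≤ (conj u * η * (ζ - z) ^ 2).re := by
    have := (abs_le.1 (Complex.abs_re_le_norm (conj u * η * (ζ - z) ^ 2))).1
    simpa [hu] using this
  nlinarith

lemma isStationary_critical {η u : ℂ} {x : ℝ} (hu : ‖u‖ = 1) (hx : ‖η‖ < x) :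
    IsStationary η u x ((x * u - conj η) / (2 * ((x : ℂ) ^ 2 - (‖η‖ : ℂ) ^ 2))) := by
  have hd : ((x : ℂ) ^ 2 - (‖η‖ : ℂ) ^ 2) ≠ 0 := by
    norm_cast
    nlinarith [norm_nonneg η]
  have huu : u * conj u = 1 := by rw [mul_conj']; simp [hu]
  have hη : (‖η‖ : ℂ) ^ 2 = η * conj η := (mul_conj' η).symm
  rw [IsStationary]
  simp only [map_div₀, map_sub, map_mul, conj_ofReal, conj_conj, map_pow, map_ofNat]
  field_simp
  rw [hη]
  linear_combination (-(x : ℂ) * conj η) * huu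

lemma norm_critical {η u : ℂ} {x : ℝ} (hx : ‖η‖ < x) :
    ‖(x * u - conj η) / (2 * ((x : ℂ) ^ 2 - (‖η‖ : ℂ) ^ 2))‖ =
      ‖x * u - conj η‖ / (2 * (x ^ 2 - ‖η‖ ^ 2)) := by
  have hd : 0 < x ^ 2 - ‖η‖ ^ 2 := by nlinarith [norm_nonneg η]
  rw [norm_div, norm_mul]
  congr 2
  · simp
  · rw [show (x : ℂ) ^ 2 - (‖η‖ : ℂ) ^ 2 = ((x ^ 2 - ‖η‖ ^ 2 : ℝ) : ℂ) by push_cast; ring,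
      norm_real, Real.norm_eq_abs, abs_of_pos hd]

lemma IsStationary.unique_multiplier {η u z w : ℂ} {x y : ℝ} (hx : IsStationary η u x z)
    (hy : IsStationary η u y w) (hu : ‖u‖ = 1) (hηx : ‖η‖ < x) (hηy : ‖η‖ < y)
    (hz : ‖z‖ = 1) (hw : ‖w‖ = 1) : x = y := by
  have h1 := hx.gap_le hu w
  have h2 := hy.gap_le hu z
  rw [norm_sub_rev z w] at h2
  simp only [hz, hw] at h1 h2
  have h3 : ‖w - z‖ ^ 2 = 0 := by
    have := sq_nonneg ‖w - z‖
    nlinarith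
  have h4 : w = z := by
    rwa [sq_eq_zero_iff, norm_eq_zero, sub_eq_zero] at h3
  subst h4
  have hw0 : w ≠ 0 := by rintro rfl; simp at hz
  have h5 : (2 * x * w : ℂ) = 2 * y * w := by
    unfold IsStationary at hx hy
    linear_combination hy - hx
  have h6 : (x : ℂ) = y := by
    have := mul_right_cancel₀ hw0 h5
    linear_combination this / 2
  exact_mod_cast h6

/-- The Karush–Kuhn–Tucker conditions for the maximum of `Re (ū cen η ζ) + t (1 - ‖ζ‖²)` over the
closed unit disk. -/
structure IsMaximizer (η : ℂ) (t : ℝ) (u : ℂ) (x : ℝ) (z : ℂ) : Prop where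
  norm_dir : ‖u‖ = 1
  norm_lt : ‖η‖ < t
  le_mult : t ≤ x
  norm_le : ‖z‖ ≤ 1
  stationary : IsStationary η u x z
  slack : x = t ∨ ‖z‖ = 1

lemma IsMaximizer.gap {η u z : ℂ} {t x : ℝ} (h : IsMaximizer η t u x z) {ζ β : ℂ}
    (hβ : ‖β‖ ≤ 1 - ‖ζ‖ ^ 2) :
    (conj u * (cen η ζ + t * β)).re + (t - ‖η‖) * ‖ζ - z‖ ^ 2 +
      t * ((1 - ‖ζ‖ ^ 2) - (conj u * β).re) ≤
      (conj u * (cen η z + rad t z * u)).re := by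
  have h1 := h.stationary.gap_le h.norm_dir ζ
  have huu : conj u * u = 1 := by rw [conj_mul']; simp [h.norm_dir]
  have e1 : (conj u * (cen η ζ + t * β)).re = (conj u * cen η ζ).re + t * (conj u * β).re := by
    rw [mul_add, add_re, mul_left_comm, re_ofReal_mul]
  have e2 : (conj u * (cen η z + rad t z * u)).re = (conj u * cen η z).re + t * (1 - ‖z‖ ^ 2) := by
    rw [mul_add, add_re, mul_left_comm, re_ofReal_mul, huu, one_re, mul_one, rad]
  have e3 : x * (1 - ‖z‖ ^ 2) = t * (1 - ‖z‖ ^ 2) := by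
    rcases h.slack with h | h
    · rw [h]
    · simp [h]
  rw [e1, e2]
  have h0 : 0 ≤ 1 - ‖ζ‖ ^ 2 := (norm_nonneg _).trans hβ
  have h2 : t * (1 - ‖ζ‖ ^ 2) ≤ x * (1 - ‖ζ‖ ^ 2) := mul_le_mul_of_nonneg_right h.le_mult h0
  have h3 : (t - ‖η‖) * ‖ζ - z‖ ^ 2 ≤ (x - ‖η‖) * ‖ζ - z‖ ^ 2 :=
    mul_le_mul_of_nonneg_right (by linarith [h.le_mult]) (sq_nonneg _)
  linarith

lemma re_conj_mul_le {u β : ℂ} (hu : ‖u‖ = 1) : (conj u * β).re ≤ ‖β‖ := by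
  have := Complex.re_le_norm (conj u * β)
  simpa [hu] using this

lemma eq_of_norm_le_re {u β : ℂ} {d : ℝ} (hu : ‖u‖ = 1) (hβ : ‖β‖ ≤ d)
    (h : d ≤ (conj u * β).re) : β = d * u := by
  have h0 : (conj u * β).re = ‖conj u * β‖ := by
    have := re_conj_mul_le (β := β) hu
    simp only [norm_mul, RCLike.norm_conj, hu, one_mul]
    linarith
  have h1 : conj u * β = (d : ℂ) := by
    have him : (conj u * β).im = 0 := by
      have h2 := Complex.sq_norm (conj u * β)
      rw [← h0, Complex.normSq_apply] at h2
      nlinarith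
    apply Complex.ext
    · rw [ofReal_re]
      exact le_antisymm ((re_conj_mul_le hu).trans hβ) h
    · rw [him, ofReal_im]
  have huu : u * conj u = 1 := by rw [mul_conj']; simp [hu]
  linear_combination u * h1 - β * huu

lemma IsMaximizer.re_le {η u z : ℂ} {t x : ℝ} (h : IsMaximizer η t u x z) {ζ β : ℂ}
    (hβ : ‖β‖ ≤ 1 - ‖ζ‖ ^ 2) :
    (conj u * (cen η ζ + t * β)).re ≤ (conj u * (cen η z + rad t z * u)).re := by
  have h1 := h.gap hβ
  have h2 := (re_conj_mul_le (β := β) h.norm_dir).trans hβ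
  have ht : 0 < t := (norm_nonneg _).trans_lt h.norm_lt
  have h3 := mul_nonneg (sub_nonneg.2 h.norm_lt.le) (sq_nonneg ‖ζ - z‖)
  have h4 := mul_nonneg ht.le (sub_nonneg.2 h2)
  linarith

lemma IsMaximizer.unique {η u z : ℂ} {t x : ℝ} (h : IsMaximizer η t u x z) {ζ β : ℂ}
    (hβ : ‖β‖ ≤ 1 - ‖ζ‖ ^ 2)
    (he : (conj u * (cen η z + rad t z * u)).re ≤ (conj u * (cen η ζ + t * β)).re) :
    ζ = z ∧ β = (1 - ‖z‖ ^ 2 : ℝ) * u := by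
  have h1 := h.gap hβ
  have h2 := (re_conj_mul_le (β := β) h.norm_dir).trans hβ
  have ht : 0 < t := (norm_nonneg _).trans_lt h.norm_lt
  have h3 := mul_nonneg (sub_nonneg.2 h.norm_lt.le) (sq_nonneg ‖ζ - z‖)
  have h4 := mul_nonneg ht.le (sub_nonneg.2 h2)
  have h5 : (t - ‖η‖) * ‖ζ - z‖ ^ 2 = 0 := by linarith
  have h6 : t * ((1 - ‖ζ‖ ^ 2) - (conj u * β).re) = 0 := by linarith
  have h7 : ζ = z := by
    rcases mul_eq_zero.1 h5 with h | h'
    · linarith [h, ‹IsMaximizer η t u x z›.norm_lt]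
    · rwa [sq_eq_zero_iff, norm_eq_zero, sub_eq_zero] at h'
  subst h7
  have h8 := (mul_eq_zero.1 h6).resolve_left ht.ne'
  exact ⟨rfl, eq_of_norm_le_re h.norm_dir hβ (by linarith)⟩

lemma norm_one_sub_sq_mul {u z : ℂ} (hu : ‖u‖ = 1) (hz : ‖z‖ ≤ 1) :
    ‖((1 - ‖z‖ ^ 2 : ℝ) : ℂ) * u‖ = 1 - ‖z‖ ^ 2 := by
  rw [norm_mul, hu, mul_one, norm_real, Real.norm_eq_abs, abs_of_nonneg]
  nlinarith [norm_nonneg z]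

lemma rad_mul (t : ℝ) (z u : ℂ) : (rad t z : ℂ) * u = t * ((1 - ‖z‖ ^ 2 : ℝ) * u) := by
  simp [rad, mul_assoc]

lemma IsMaximizer.mem {η u z : ℂ} {t x : ℝ} (h : IsMaximizer η t u x z) :
    cen η z + rad t z * u ∈ diskUnion η t :=
  ⟨z, (1 - ‖z‖ ^ 2 : ℝ) * u, (norm_one_sub_sq_mul h.norm_dir h.norm_le).le, by rw [rad_mul]⟩

lemma IsMaximizer.mem_frontier {η u z : ℂ} {t x : ℝ} (h : IsMaximizer η t u x z) :
    cen η z + rad t z * u ∈ frontier (diskUnion η t) := by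
  refine ⟨subset_closure h.mem, fun hint => ?_⟩
  rw [mem_interior_iff_mem_nhds, Metric.mem_nhds_iff] at hint
  obtain ⟨ε, hε, hsub⟩ := hint
  have hmem : cen η z + rad t z * u + (ε / 2 : ℝ) * u ∈ diskUnion η t := by
    apply hsub
    rw [mem_ball_iff_norm, add_sub_cancel_left, norm_mul, h.norm_dir, norm_real, Real.norm_eq_abs,
      abs_of_pos (by positivity)]
    linarith
  obtain ⟨ζ, β, hβ, he⟩ := hmem
  have h1 := h.re_le hβ
  have huu : conj u * u = 1 := by rw [conj_mul']; simp [h.norm_dir]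
  rw [← he, mul_add _ _ (((ε / 2 : ℝ) : ℂ) * u), add_re, mul_left_comm, huu, mul_one,
    ofReal_re] at h1
  linarith

lemma IsMaximizer.dir_eq {η u v z w : ℂ} {t x y : ℝ} (hu : IsMaximizer η t u x z)
    (hv : IsMaximizer η t v y w)
    (he : cen η z + rad t z * u = cen η w + rad t w * v) : u = v := by
  have h1 := hu.unique (ζ := w) (β := (1 - ‖w‖ ^ 2 : ℝ) * v)
    (norm_one_sub_sq_mul hv.norm_dir hv.norm_le).le (by rw [he, rad_mul])
  obtain ⟨rfl, h2⟩ := h1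
  by_cases hz : ‖w‖ = 1
  · have ex := hu.stationary
    have ey := hv.stationary
    unfold IsStationary at ex ey
    have ht : 0 < t := (norm_nonneg _).trans_lt hu.norm_lt
    have hx : 0 < x := ht.trans_le hu.le_mult
    have hy : 0 < y := ht.trans_le hv.le_mult
    have ex' : u * (1 - 2 * conj η * conj w) = 2 * x * w := by linear_combination ex
    have ey' : v * (1 - 2 * conj η * conj w) = 2 * y * w := by linear_combination ey
    have nx := congrArg norm ex'
    have ny := congrArg norm ey'
    simp only [norm_mul, hu.norm_dir, hv.norm_dir, hz, norm_real, Real.norm_eq_abs, abs_of_pos hx,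
      abs_of_pos hy, Complex.norm_ofNat, one_mul, mul_one] at nx ny
    have hxy : x = y := by linarith
    have hne : (1 - 2 * conj η * conj w) ≠ 0 := by
      intro h0
      rw [h0, norm_zero] at nx
      linarith
    apply mul_right_cancel₀ hne
    rw [ex', ey', hxy]
  · have hlt : ‖w‖ < 1 := lt_of_le_of_ne hu.norm_le hz
    have hne : ((1 - ‖w‖ ^ 2 : ℝ) : ℂ) ≠ 0 := by
      have : 0 < 1 - ‖w‖ ^ 2 := by nlinarith [norm_nonneg w]
      exact_mod_cast this.ne'
    exact (mul_left_cancel₀ hne h2).symm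

lemma norm_cen_sub_le {η z w : ℂ} (hz : ‖z‖ ≤ 1) (hw : ‖w‖ ≤ 1) :
    ‖cen η z - cen η w‖ ≤ (1 + 2 * ‖η‖) * ‖z - w‖ := by
  have : cen η z - cen η w = (1 - η * (z + w)) * (z - w) := by unfold cen; ring
  rw [this, norm_mul]
  gcongr
  refine (norm_sub_le _ _).trans ?_
  rw [norm_one, norm_mul]
  have := (norm_add_le z w).trans (add_le_add hz hw)
  nlinarith [norm_nonneg η]

/-- The maximizer depends in a Lipschitz way on the direction. -/
lemma IsMaximizer.dist_le {η u v z w : ℂ} {t x y : ℝ} (hu : IsMaximizer η t u x z)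
    (hv : IsMaximizer η t v y w) :
    2 * (t - ‖η‖) * ‖z - w‖ ≤ (1 + 2 * ‖η‖) * ‖u - v‖ := by
  have huu : conj u * u = 1 := by rw [conj_mul']; simp [hu.norm_dir]
  have hvv : conj v * v = 1 := by rw [conj_mul']; simp [hv.norm_dir]
  have h1 := hu.gap (ζ := w) (β := (1 - ‖w‖ ^ 2 : ℝ) * u)
    (norm_one_sub_sq_mul hu.norm_dir hv.norm_le).le
  have h2 := hv.gap (ζ := z) (β := (1 - ‖z‖ ^ 2 : ℝ) * v)
    (norm_one_sub_sq_mul hv.norm_dir hu.norm_le).le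
  rw [rad_mul] at h1 h2
  simp only [mul_add, add_re, mul_left_comm (conj u), mul_left_comm (conj v), huu, hvv,
    re_ofReal_mul, ofReal_re, mul_one, sub_self, mul_zero] at h1 h2
  rw [norm_sub_rev w z] at h1
  have h3 : (conj (u - v) * (cen η z - cen η w)).re ≤
      ‖u - v‖ * ((1 + 2 * ‖η‖) * ‖z - w‖) := by
    refine (Complex.re_le_norm _).trans ?_
    rw [norm_mul, RCLike.norm_conj]
    exact mul_le_mul_of_nonneg_left (norm_cen_sub_le hu.norm_le hv.norm_le) (norm_nonneg _)
  have h4 : (conj (u - v) * (cen η z - cen η w)).re =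
      (conj u * cen η z).re - (conj u * cen η w).re - (conj v * cen η z).re
        + (conj v * cen η w).re := by
    simp only [map_sub, sub_mul, mul_sub, sub_re]; ring
  rcases eq_or_lt_of_le (norm_nonneg (z - w)) with h0 | h0
  · rw [← h0, mul_zero]; positivity
  · have : 2 * (t - ‖η‖) * ‖z - w‖ * ‖z - w‖ ≤ (1 + 2 * ‖η‖) * ‖u - v‖ * ‖z - w‖ := by
      nlinarith
    exact le_of_mul_le_mul_right this h0

lemma exists_isSol_ge {η : ℂ} {t θ : ℝ} (h : ‖η‖ < t)
    (hge : 2 * (t ^ 2 - ‖η‖ ^ 2) ≤ ‖t * exp (θ * I) - conj η‖) : ∃ x, t ≤ x ∧ IsSol η θ x := by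
  have hcont : ContinuousOn (fun x : ℝ => ‖(x : ℂ) * exp (θ * I) - conj η‖ -
      2 * (x ^ 2 - ‖η‖ ^ 2)) (Icc t (t + 1)) := by fun_prop
  have h1 : ‖((t + 1 : ℝ) : ℂ) * exp (θ * I) - conj η‖ - 2 * ((t + 1) ^ 2 - ‖η‖ ^ 2) ≤ 0 := by
    have := norm_sub_le (((t + 1 : ℝ) : ℂ) * exp (θ * I)) (conj η)
    rw [norm_mul, norm_exp_ofReal_mul_I, norm_real, Real.norm_eq_abs,
      abs_of_nonneg (by linarith [norm_nonneg η]), RCLike.norm_conj] at this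
    nlinarith [norm_nonneg η]
  obtain ⟨x, hx, he⟩ := intermediate_value_Icc' (by linarith : t ≤ t + 1) hcont
    (⟨h1, by simpa using hge⟩ : (0 : ℝ) ∈ Icc _ _)
  exact ⟨x, hx.1, h.trans_le hx.1, by simpa [sub_eq_zero] using he⟩

lemma IsSol.norm_critical {η : ℂ} {θ x : ℝ} (h : IsSol η θ x) :
    ‖(x * exp (θ * I) - conj η) / (2 * ((x : ℂ) ^ 2 - (‖η‖ : ℂ) ^ 2))‖ = 1 := by
  rw [ThirdDieudonne.norm_critical h.1, h.2, div_self]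
  nlinarith [h.1, norm_nonneg η]

lemma IsSol.unique {η : ℂ} {θ x y : ℝ} (hx : IsSol η θ x) (hy : IsSol η θ y) : x = y :=
  (isStationary_critical (norm_exp_ofReal_mul_I θ) hx.1).unique_multiplier
    (isStationary_critical (norm_exp_ofReal_mul_I θ) hy.1) (norm_exp_ofReal_mul_I θ) hx.1 hy.1
    hx.norm_critical hy.norm_critical

lemma tTheta_of_le {η : ℂ} {t θ : ℝ} (h : ‖η‖ < t)
    (hge : 2 * (t ^ 2 - ‖η‖ ^ 2) ≤ ‖t * exp (θ * I) - conj η‖) :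
    t ≤ tTheta η t θ ∧ IsSol η θ (tTheta η t θ) := by
  obtain ⟨x, hx, hsol⟩ := exists_isSol_ge h hge
  have h1 : IsSol η θ (tTheta η t θ) := by
    rw [tTheta, if_pos hge]
    exact Classical.epsilon_spec (p := fun x => IsSol η θ x) ⟨x, hsol⟩
  exact ⟨by rw [← hsol.unique h1]; exact hx, h1⟩

lemma tTheta_of_lt {η : ℂ} {t θ : ℝ}
    (hlt : ‖t * exp (θ * I) - conj η‖ < 2 * (t ^ 2 - ‖η‖ ^ 2)) : tTheta η t θ = t := by
  rw [tTheta, if_neg (not_le.2 hlt)]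

lemma norm_zetaTheta_of_le {η : ℂ} {t θ : ℝ} (h : ‖η‖ < t)
    (hge : 2 * (t ^ 2 - ‖η‖ ^ 2) ≤ ‖t * exp (θ * I) - conj η‖) : ‖zetaTheta η t θ‖ = 1 :=
  (tTheta_of_le h hge).2.norm_critical

lemma isMaximizer_zetaTheta {η : ℂ} {t : ℝ} (h : ‖η‖ < t) (θ : ℝ) :
    IsMaximizer η t (exp (θ * I)) (tTheta η t θ) (zetaTheta η t θ) := by
  rcases le_or_gt (2 * (t ^ 2 - ‖η‖ ^ 2)) ‖t * exp (θ * I) - conj η‖ with hge | hlt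
  · obtain ⟨h1, h2⟩ := tTheta_of_le h hge
    have hn := norm_zetaTheta_of_le h hge
    exact ⟨norm_exp_ofReal_mul_I θ, h, h1, hn.le,
      isStationary_critical (norm_exp_ofReal_mul_I θ) h2.1, Or.inr hn⟩
  · have h1 := tTheta_of_lt hlt
    refine ⟨norm_exp_ofReal_mul_I θ, h, h1.ge, ?_,
      isStationary_critical (norm_exp_ofReal_mul_I θ) (by rwa [h1]), Or.inl h1⟩
    rw [zetaTheta, norm_critical (by rwa [h1]), h1]
    exact (div_le_one (by nlinarith [norm_nonneg η])).2 hlt.le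

/-- The boundary point of `diskUnion η t` with outer normal `e^{iθ}`. -/
noncomputable def supportPoint (η : ℂ) (t θ : ℝ) : ℂ :=
  cen η (zetaTheta η t θ) + rad t (zetaTheta η t θ) * exp (θ * I)

lemma supportPoint_of_norm_eq_one {η : ℂ} {t θ : ℝ} (h : ‖zetaTheta η t θ‖ = 1) :
    supportPoint η t θ = cen η (zetaTheta η t θ) := by
  simp [supportPoint, rad, h]

lemma continuous_zetaTheta {η : ℂ} {t : ℝ} (h : ‖η‖ < t) : Continuous (zetaTheta η t) := by
  rw [continuous_iff_continuousAt]
  intro θ₀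
  rw [ContinuousAt, tendsto_iff_norm_sub_tendsto_zero]
  have hpos : 0 < 2 * (t - ‖η‖) := by linarith
  have hlim : Filter.Tendsto (fun θ : ℝ => (1 + 2 * ‖η‖) * ‖exp (θ * I) - exp (θ₀ * I)‖ /
      (2 * (t - ‖η‖))) (𝓝 θ₀) (𝓝 0) := by
    have hc : Continuous (fun θ : ℝ => (1 + 2 * ‖η‖) * ‖exp (θ * I) - exp (θ₀ * I)‖ /
      (2 * (t - ‖η‖))) := by fun_prop
    simpa using hc.tendsto θ₀
  refine squeeze_zero (fun _ => norm_nonneg _) (fun θ => ?_) hlim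
  rw [le_div_iff₀ hpos, mul_comm]
  exact (isMaximizer_zetaTheta h θ).dist_le (isMaximizer_zetaTheta h θ₀)

lemma continuous_supportPoint {η : ℂ} {t : ℝ} (h : ‖η‖ < t) : Continuous (supportPoint η t) := by
  have := continuous_zetaTheta h
  unfold supportPoint cen rad
  fun_prop

lemma exp_periodic (θ : ℝ) : exp (((θ + 2 * Real.pi : ℝ) : ℂ) * I) = exp (θ * I) := by
  push_cast
  rw [add_mul, exp_add, exp_two_pi_mul_I, mul_one]

lemma isSol_periodic (η : ℂ) (θ : ℝ) : IsSol η (θ + 2 * Real.pi) = IsSol η θ := by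
  funext x
  unfold IsSol
  rw [exp_periodic]

lemma periodic_supportPoint (η : ℂ) (t : ℝ) :
    Function.Periodic (supportPoint η t) (2 * Real.pi) := by
  intro θ
  have h1 : tTheta η t (θ + 2 * Real.pi) = tTheta η t θ := by
    unfold tTheta
    rw [exp_periodic, isSol_periodic]
  unfold supportPoint zetaTheta
  rw [h1, exp_periodic]

lemma interior_diskUnion_nonempty {η : ℂ} {t : ℝ} (h : ‖η‖ < t) :
    (interior (diskUnion η t)).Nonempty :=
  ⟨0, interior_maximal (ball_subset_diskUnion ((norm_nonneg _).trans_lt h)) isOpen_ball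
    (mem_ball_self ((norm_nonneg _).trans_lt h))⟩

lemma closure_interior_diskUnion {η : ℂ} {t : ℝ} (h : ‖η‖ < t) :
    closure (interior (diskUnion η t)) = diskUnion η t := by
  rw [(convex_diskUnion h).closure_interior_eq_closure_of_nonempty_interior
    (interior_diskUnion_nonempty h), (isCompact_diskUnion η t).isClosed.closure_eq]

lemma exists_supporting_direction {K : Set ℂ} (hK : Convex ℝ K) (hcl : closure (interior K) = K)
    (hne : (interior K).Nonempty) {w : ℂ} (hw : w ∉ interior K) :
    ∃ θ ∈ Ioc (-Real.pi) Real.pi, ∀ a ∈ K, (conj (exp (θ * I)) * a).re ≤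
      (conj (exp (θ * I)) * w).re := by
  obtain ⟨f, hf⟩ := geometric_hahn_banach_open_point hK.interior isOpen_interior hw
  have hf' : ∀ a ∈ K, f a ≤ f w := by
    intro a ha
    rw [← hcl] at ha
    exact closure_minimal (fun b hb => (hf b hb).le)
      (isClosed_le f.continuous continuous_const) ha
  set v : ℂ := f 1 + f I * I with hv
  have hrep : ∀ a : ℂ, f a = (conj v * a).re := by
    intro a
    have : a = a.re • (1 : ℂ) + a.im • I := by
      simp [re_add_im]
    conv_lhs => rw [this]
    rw [map_add, map_smul, map_smul]
    simp [hv]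
    ring
  have hv0 : v ≠ 0 := by
    intro h0
    obtain ⟨a, ha⟩ := hne
    have := hf a ha
    rw [hrep, hrep, h0] at this
    simp at this
  refine ⟨arg v, ⟨neg_pi_lt_arg v, arg_le_pi v⟩, fun a ha => ?_⟩
  have h1 := hf' a ha
  rw [hrep, hrep] at h1
  have hpolar : conj v = (‖v‖ : ℂ) * conj (exp (arg v * I)) := by
    conv_lhs => rw [← norm_mul_exp_arg_mul_I v]
    rw [map_mul, conj_ofReal]
  rw [hpolar, mul_assoc, mul_assoc, re_ofReal_mul, re_ofReal_mul] at h1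
  exact le_of_mul_le_mul_left h1 (norm_pos_iff.2 hv0)

lemma bijOn_supportPoint {η : ℂ} {t : ℝ} (h : ‖η‖ < t) :
    BijOn (supportPoint η t) (Ioc (-Real.pi) Real.pi) (frontier (diskUnion η t)) := by
  refine ⟨fun θ _ => (isMaximizer_zetaTheta h θ).mem_frontier, ?_, ?_⟩
  · intro θ hθ φ hφ he
    have h1 := (isMaximizer_zetaTheta h θ).dir_eq (isMaximizer_zetaTheta h φ) he
    have h2 := congrArg arg h1
    rwa [arg_exp_mul_I, arg_exp_mul_I, (toIocMod_eq_self _).2 (by convert hθ using 1; ring_nf),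
      (toIocMod_eq_self _).2 (by convert hφ using 1; ring_nf)] at h2
  · intro w hw
    obtain ⟨θ, hθ, hle⟩ := exists_supporting_direction (convex_diskUnion h)
      (closure_interior_diskUnion h) (interior_diskUnion_nonempty h) hw.2
    refine ⟨θ, hθ, ?_⟩
    have hmax := isMaximizer_zetaTheta h θ
    have hwK : w ∈ diskUnion η t := (isCompact_diskUnion η t).isClosed.closure_eq ▸ hw.1
    obtain ⟨ζ, β, hβ, rfl⟩ := hwK
    obtain ⟨rfl, rfl⟩ := hmax.unique hβ (hle _ hmax.mem)
    rw [supportPoint, rad_mul]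

lemma isJordanCurve_of_periodic {γ : ℝ → ℂ} (hc : Continuous γ)
    (hp : Function.Periodic γ (2 * Real.pi)) {J : Set ℂ}
    (hb : BijOn γ (Ioc (-Real.pi) Real.pi) J) : IsJordanCurve J := by
  have : Fact (0 < 2 * Real.pi) := ⟨Real.two_pi_pos⟩
  have hIoc : Ioc (-Real.pi) (-Real.pi + 2 * Real.pi) = Ioc (-Real.pi) Real.pi := by ring_nf
  set F : AddCircle (2 * Real.pi) → ℂ := AddCircle.liftIoc (2 * Real.pi) (-Real.pi) γ with hF
  have hFc : Continuous F := AddCircle.liftIoc_continuous (hp _).symm hc.continuousOn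
  have hrep : ∀ y : AddCircle (2 * Real.pi), ∃ x ∈ Ioc (-Real.pi) Real.pi, (x : AddCircle _) = y ∧
      F y = γ x := by
    intro y
    set x := AddCircle.equivIoc (2 * Real.pi) (-Real.pi) y
    have hy : ((x : ℝ) : AddCircle (2 * Real.pi)) = y :=
      (AddCircle.equivIoc (2 * Real.pi) (-Real.pi)).symm_apply_apply y
    exact ⟨x, hIoc ▸ x.2, hy, rfl⟩
  refine ⟨F ∘ AddCircle.homeomorphCircle'.symm,
    hFc.comp AddCircle.homeomorphCircle'.symm.continuous, ?_, ?_⟩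
  · refine Function.Injective.comp ?_ AddCircle.homeomorphCircle'.symm.injective
    intro y y' he
    obtain ⟨x, hx, rfl, h1⟩ := hrep y
    obtain ⟨x', hx', rfl, h2⟩ := hrep y'
    rw [hb.injOn hx hx' (by rw [← h1, ← h2, he])]
  · rw [AddCircle.homeomorphCircle'.symm.surjective.range_comp]
    ext w
    constructor
    · rintro ⟨y, rfl⟩
      obtain ⟨x, hx, -, h1⟩ := hrep y
      rw [h1]; exact hb.mapsTo hx
    · intro hw
      obtain ⟨x, hx, rfl⟩ := hb.surjOn hw
      exact ⟨x, AddCircle.liftIoc_coe_apply (hIoc ▸ hx)⟩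

lemma one_add_conj_mul_ne_zero {a z : ℂ} (ha : ‖a‖ < 1) (hz : ‖z‖ ≤ 1) :
    1 + conj a * z ≠ 0 := by
  intro h
  have h1 : conj a * z = -1 := by linear_combination h
  have h2 := congrArg norm h1
  rw [norm_mul, RCLike.norm_conj, norm_neg, norm_one] at h2
  nlinarith [norm_nonneg a, norm_nonneg z]

lemma one_sub_norm_T_sq {a z : ℂ} (h : 1 + conj a * z ≠ 0) :
    1 - ‖T a z‖ ^ 2 = (1 - ‖a‖ ^ 2) * (1 - ‖z‖ ^ 2) / ‖1 + conj a * z‖ ^ 2 := by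
  have h0 : ‖1 + conj a * z‖ ^ 2 ≠ 0 := by positivity
  rw [T, norm_div, div_pow, eq_div_iff h0, sub_mul, div_mul_cancel₀ _ h0]
  simp only [Complex.sq_norm, Complex.normSq_apply, add_re, add_im, mul_re, mul_im, conj_re,
    conj_im, one_re, one_im]
  ring

lemma norm_T_le_one {a z : ℂ} (ha : ‖a‖ < 1) (hz : ‖z‖ ≤ 1) : ‖T a z‖ ≤ 1 := by
  have h := one_sub_norm_T_sq (one_add_conj_mul_ne_zero ha hz)
  have h1 : 0 ≤ (1 - ‖a‖ ^ 2) * (1 - ‖z‖ ^ 2) / ‖1 + conj a * z‖ ^ 2 := by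
    refine div_nonneg (mul_nonneg ?_ ?_) (sq_nonneg _) <;>
      nlinarith [norm_nonneg a, norm_nonneg z]
  nlinarith [norm_nonneg (T a z)]

lemma norm_T_lt_one {a z : ℂ} (ha : ‖a‖ < 1) (hz : ‖z‖ < 1) : ‖T a z‖ < 1 := by
  have hne := one_add_conj_mul_ne_zero ha hz.le
  have h := one_sub_norm_T_sq hne
  have h1 : 0 < (1 - ‖a‖ ^ 2) * (1 - ‖z‖ ^ 2) / ‖1 + conj a * z‖ ^ 2 := by
    refine div_pos (mul_pos ?_ ?_) (by positivity) <;>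
      nlinarith [norm_nonneg a, norm_nonneg z]
  nlinarith [norm_nonneg (T a z)]

@[simp] lemma T_apply_zero (a : ℂ) : T a 0 = a := by simp [T]

@[simp] lemma T_neg_apply_self (a : ℂ) : T (-a) a = 0 := by simp [T]

lemma T_T_neg {a z : ℂ} (ha : ‖a‖ < 1) (hz : ‖z‖ ≤ 1) : T a (T (-a) z) = z := by
  have h1 : 1 + conj (-a) * z ≠ 0 := one_add_conj_mul_ne_zero (by simpa) hz
  have h2 : 1 - conj a * z ≠ 0 := by simpa [sub_eq_add_neg] using h1
  have h3 : 1 + conj a * T (-a) z ≠ 0 :=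
    one_add_conj_mul_ne_zero ha (norm_T_le_one (by simpa) hz)
  have h4 : T (-a) z * (1 - conj a * z) = z - a := by
    have : 1 - conj a * z = 1 + conj (-a) * z := by rw [map_neg]; ring
    rw [this, T, div_mul_cancel₀ _ h1, sub_eq_add_neg]
  rw [T, div_eq_iff h3]
  apply mul_right_cancel₀ h2
  linear_combination (1 - conj a * z) * h4

lemma differentiableOn_T_comp {a : ℂ} {k : ℂ → ℂ} {S : Set ℂ} (ha : ‖a‖ < 1)
    (hk : DifferentiableOn ℂ k S) (hb : ∀ z ∈ S, ‖k z‖ ≤ 1) :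
    DifferentiableOn ℂ (fun z => T a (k z)) S := by
  unfold T
  exact (hk.add_const a).div ((hk.const_mul _).const_add 1)
    fun z hz => one_add_conj_mul_ne_zero ha (hb z hz)

lemma differentiableOn_T {a : ℂ} (ha : ‖a‖ < 1) : DifferentiableOn ℂ (T a) (ball 0 1) :=
  differentiableOn_T_comp (k := id) ha differentiableOn_id
    fun _ hz => (mem_ball_zero_iff.1 hz).le

/-- Analytic functions on the unit disk bounded by one. -/
structure IsSchur (k : ℂ → ℂ) : Prop where
  diff : DifferentiableOn ℂ k (ball 0 1)
  norm_le : ∀ z ∈ ball (0 : ℂ) 1, ‖k z‖ ≤ 1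

lemma isSchur_const {c : ℂ} (hc : ‖c‖ ≤ 1) : IsSchur fun _ => c :=
  ⟨differentiableOn_const _, fun _ _ => hc⟩

lemma isSchur_T {a : ℂ} (ha : ‖a‖ < 1) : IsSchur (T a) :=
  ⟨differentiableOn_T ha, fun _ hz => norm_T_le_one ha (mem_ball_zero_iff.1 hz).le⟩

lemma IsSchur.mul {k l : ℂ → ℂ} (hk : IsSchur k) (hl : IsSchur l) :
    IsSchur fun z => k z * l z :=
  ⟨hk.diff.mul hl.diff, fun z hz => by
    rw [norm_mul]; exact mul_le_one₀ (hk.norm_le z hz) (norm_nonneg _) (hl.norm_le z hz)⟩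

lemma IsSchur.T_comp {a : ℂ} {k : ℂ → ℂ} (ha : ‖a‖ < 1) (hk : IsSchur k) :
    IsSchur fun z => T a (k z) :=
  ⟨differentiableOn_T_comp ha hk.diff hk.norm_le, fun z hz => norm_T_le_one ha (hk.norm_le z hz)⟩

lemma IsSchur.eqOn_const {k : ℂ → ℂ} (hk : IsSchur k) {p : ℂ} (hp : p ∈ ball (0 : ℂ) 1)
    (h : ‖k p‖ = 1) : ∀ z ∈ ball (0 : ℂ) 1, k z = k p :=
  Complex.eqOn_of_isPreconnected_of_isMaxOn_norm (convex_ball 0 1).isPreconnected isOpen_ball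
    hk.diff hp fun z hz => by
      simp only [mem_ofPred_eq, Function.comp, h]; exact hk.norm_le z hz

/-- One step of Schur's algorithm: the Schwarz–Pick lemma in factored form. -/
lemma IsSchur.exists_factor {g : ℂ → ℂ} (hg : IsSchur g) {p : ℂ} (hp : ‖p‖ < 1)
    (ha : ‖g p‖ < 1) : ∃ k, IsSchur k ∧ ∀ z ∈ ball (0 : ℂ) 1,
      g z = T (g p) (T (-p) z * k z) := by
  have hTp : MapsTo (T p) (ball 0 1) (ball 0 1) := fun w hw =>
    mem_ball_zero_iff.2 (norm_T_lt_one hp (mem_ball_zero_iff.1 hw))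
  have hTp' : MapsTo (T (-p)) (ball 0 1) (ball 0 1) := fun w hw =>
    mem_ball_zero_iff.2 (norm_T_lt_one (by simpa) (mem_ball_zero_iff.1 hw))
  have ha' : ‖-g p‖ < 1 := by simpa
  have hp' : ‖-p‖ < 1 := by simpa
  set G : ℂ → ℂ := fun w => T (-g p) (g (T p w)) with hG
  have hGd : DifferentiableOn ℂ G (ball 0 1) :=
    differentiableOn_T_comp ha' (hg.diff.comp (differentiableOn_T hp) hTp)
      fun z hz => hg.norm_le _ (hTp hz)
  have hG0 : G 0 = 0 := by simp [hG]
  have hGm : MapsTo G (ball 0 1) (closedBall (G 0) 1) := fun w hw => by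
    rw [hG0, mem_closedBall_zero_iff]
    exact norm_T_le_one ha' (hg.norm_le _ (hTp hw))
  refine ⟨fun z => dslope G 0 (T (-p) z), ⟨?_, fun z hz => ?_⟩, fun z hz => ?_⟩
  · exact ((Complex.differentiableOn_dslope (ball_mem_nhds 0 one_pos)).2 hGd).comp
      (differentiableOn_T hp') hTp'
  · simpa using Complex.norm_dslope_le_div_of_mapsTo_ball hGd hGm (hTp' hz)
  · have hz1 := (mem_ball_zero_iff.1 hz).le
    have h1 := sub_smul_dslope G 0 (T (-p) z)
    rw [sub_zero, hG0, sub_zero, smul_eq_mul] at h1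
    rw [h1]
    simp only [hG]
    rw [T_T_neg hp hz1, T_T_neg ha (hg.norm_le z hz)]

/-- The function of `H₀` with Schur parameters `s / r`, `lam` at `r` and remainder `k`. -/
noncomputable def schurExtension (r s : ℝ) (lam : ℂ) (k : ℂ → ℂ) (z : ℂ) : ℂ :=
  z * T (s / r) (T (-r) z * T lam (T (-r) z * k z))

lemma norm_div_lt_one {r s : ℝ} (hs : 0 ≤ s) (hsr : s < r) : ‖(s / r : ℂ)‖ < 1 := by
  have hr0 : 0 < r := hs.trans_lt hsr
  rw [norm_div, norm_real, norm_real, Real.norm_eq_abs, Real.norm_eq_abs, abs_of_nonneg hs,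
    abs_of_pos hr0]
  exact (div_lt_one hr0).2 hsr

lemma norm_ofReal_lt_one {r : ℝ} (h0 : 0 < r) (hr : r < 1) : ‖(r : ℂ)‖ < 1 := by
  rwa [norm_real, Real.norm_eq_abs, abs_of_pos h0]

lemma IsSchur.inner {r : ℝ} {lam : ℂ} {k : ℂ → ℂ} (h0 : 0 < r) (hr : r < 1) (hlam : ‖lam‖ < 1)
    (hk : IsSchur k) : IsSchur fun z => T lam (T (-r) z * k z) :=
  ((isSchur_T (by simpa using norm_ofReal_lt_one h0 hr)).mul hk).T_comp hlam

lemma schurExtension_memH0 {r s : ℝ} (hs : 0 ≤ s) (hsr : s < r) (hr : r < 1) {lam : ℂ}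
    (hlam : ‖lam‖ < 1) {k : ℂ → ℂ} (hk : IsSchur k) : MemH0 (schurExtension r s lam k) := by
  have h0 : 0 < r := hs.trans_lt hsr
  have h1 := (hk.inner h0 hr hlam).inner h0 hr (norm_div_lt_one hs hsr)
  refine ⟨differentiableOn_id.mul h1.diff, fun z hz => ?_, by simp [schurExtension]⟩
  rw [mem_ball_zero_iff] at hz ⊢
  rw [schurExtension, norm_mul]
  exact (mul_le_of_le_one_right (norm_nonneg _) (h1.norm_le z (mem_ball_zero_iff.2 hz))).trans_lt hz

/-- `f` has the third order Taylor polynomial `a + b (z-p) + c (z-p)² + d (z-p)³` at `p`. -/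
def HasJet (f : ℂ → ℂ) (p a b c d : ℂ) : Prop :=
  ∃ F : ℂ → ℂ, AnalyticAt ℂ F p ∧ ∀ᶠ z in 𝓝 p,
    f z = a + b * (z - p) + c * (z - p) ^ 2 + d * (z - p) ^ 3 + (z - p) ^ 4 * F z

lemma _root_.AnalyticAt.dslope_self {f : ℂ → ℂ} {p : ℂ} (hf : AnalyticAt ℂ f p) :
    AnalyticAt ℂ (dslope f p) p := by
  obtain ⟨q, hq⟩ := hf
  exact ⟨_, hq.has_fpower_series_dslope_fslope⟩

lemma exists_hasJet {f : ℂ → ℂ} {p : ℂ} (hf : AnalyticAt ℂ f p) :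
    ∃ a b c d, HasJet f p a b c d := by
  have key : ∀ (g : ℂ → ℂ) z, g z = g p + (z - p) * dslope g p z := fun g z => by
    have := sub_smul_dslope g p z
    rw [smul_eq_mul] at this
    rw [this]; ring
  refine ⟨f p, dslope f p p, dslope (dslope f p) p p, dslope (dslope (dslope f p) p) p p, _,
    hf.dslope_self.dslope_self.dslope_self.dslope_self, Filter.Eventually.of_forall fun z => ?_⟩
  conv_lhs => rw [key f z, key (dslope f p) z, key (dslope (dslope f p) p) z,
    key (dslope (dslope (dslope f p) p) p) z]
  ring

lemma HasJet.congr {f g : ℂ → ℂ} {p a b c d : ℂ} (hf : HasJet f p a b c d)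
    (h : g =ᶠ[𝓝 p] f) : HasJet g p a b c d := by
  obtain ⟨F, hF, hf⟩ := hf
  exact ⟨F, hF, by filter_upwards [h, hf] with z h1 h2; rw [h1, h2]⟩

lemma HasJet.add {f g : ℂ → ℂ} {p a b c d a' b' c' d' : ℂ} (hf : HasJet f p a b c d)
    (hg : HasJet g p a' b' c' d') :
    HasJet (fun z => f z + g z) p (a + a') (b + b') (c + c') (d + d') := by
  obtain ⟨F, hF, hf⟩ := hf
  obtain ⟨G, hG, hg⟩ := hg
  refine ⟨fun z => F z + G z, hF.add hG, ?_⟩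
  filter_upwards [hf, hg] with z h1 h2
  rw [h1, h2]; ring

lemma HasJet.mul {f g : ℂ → ℂ} {p a b c d a' b' c' d' : ℂ} (hf : HasJet f p a b c d)
    (hg : HasJet g p a' b' c' d') :
    HasJet (fun z => f z * g z) p (a * a') (a * b' + b * a') (a * c' + b * b' + c * a')
      (a * d' + b * c' + c * b' + d * a') := by
  obtain ⟨F, hF, hf⟩ := hf
  obtain ⟨G, hG, hg⟩ := hg
  refine ⟨fun z => (b * d' + c * c' + d * b') + (c * d' + d * c') * (z - p) + d * d' * (z - p) ^ 2 +
    (a + b * (z - p) + c * (z - p) ^ 2 + d * (z - p) ^ 3) * G z +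
    (a' + b' * (z - p) + c' * (z - p) ^ 2 + d' * (z - p) ^ 3) * F z + (z - p) ^ 4 * F z * G z,
    by fun_prop, ?_⟩
  filter_upwards [hf, hg] with z h1 h2
  rw [h1, h2]; ring

lemma hasJet_const (p c : ℂ) : HasJet (fun _ => c) p c 0 0 0 :=
  ⟨fun _ => 0, analyticAt_const, Filter.Eventually.of_forall fun z => by ring⟩

lemma hasJet_id (p : ℂ) : HasJet (fun z => z) p p 1 0 0 :=
  ⟨fun _ => 0, analyticAt_const, Filter.Eventually.of_forall fun z => by ring⟩

lemma deriv_eventuallyEq_of_remainder {f Q Q' F : ℂ → ℂ} {p : ℂ} {n : ℕ}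
    (hQ : ∀ z, HasDerivAt Q (Q' z) z) (hF : AnalyticAt ℂ F p)
    (h : ∀ᶠ z in 𝓝 p, f z = Q z + (z - p) ^ (n + 1) * F z) :
    ∃ G, AnalyticAt ℂ G p ∧ ∀ᶠ z in 𝓝 p, deriv f z = Q' z + (z - p) ^ n * G z := by
  refine ⟨fun z => (n + 1) * F z + (z - p) * deriv F z, ?_, ?_⟩
  · have := hF.deriv
    fun_prop
  · filter_upwards [h.eventually_nhds, hF.eventually_analyticAt] with z hz hFz
    have h1 := (hQ z).add (((((hasDerivAt_id z).sub_const p).pow (n + 1)).mul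
      hFz.differentiableAt.hasDerivAt))
    rw [Filter.EventuallyEq.deriv_eq (f := fun z => Q z + (z - p) ^ (n + 1) * F z) hz]
    refine h1.deriv.trans ?_
    simp only [id, Nat.add_sub_cancel, Pi.pow_apply]
    push_cast
    ring

lemma HasJet.derivs {f : ℂ → ℂ} {p a b c d : ℂ} (h : HasJet f p a b c d) :
    f p = a ∧ deriv f p = b ∧ iteratedDeriv 2 f p = 2 * c ∧ iteratedDeriv 3 f p = 6 * d := by
  obtain ⟨F, hF, h⟩ := h
  have hx : ∀ z : ℂ, HasDerivAt (fun z => z - p) 1 z := fun z => (hasDerivAt_id z).sub_const p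
  have hx2 : ∀ z : ℂ, HasDerivAt (fun z => (z - p) ^ 2) (2 * (z - p)) z := fun z => by
    simpa using (hx z).fun_pow 2
  have hx3 : ∀ z : ℂ, HasDerivAt (fun z => (z - p) ^ 3) (3 * (z - p) ^ 2) z := fun z => by
    simpa using (hx z).fun_pow 3
  have h0 := h.self_of_nhds
  obtain ⟨F₁, hF₁, h1⟩ := deriv_eventuallyEq_of_remainder (n := 3)
    (Q' := fun z => b + c * (2 * (z - p)) + d * (3 * (z - p) ^ 2))
    (fun z => by
      simpa using ((((hx z).const_mul b).const_add a).fun_add ((hx2 z).const_mul c)).fun_add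
        ((hx3 z).const_mul d)) hF h
  obtain ⟨F₂, hF₂, h2⟩ := deriv_eventuallyEq_of_remainder (n := 2)
    (Q' := fun z => c * 2 + d * (3 * (2 * (z - p))))
    (fun z => by
      simpa using (((((hx z).const_mul 2).const_mul c).const_add b)).fun_add
        (((hx2 z).const_mul 3).const_mul d)) hF₁ h1
  obtain ⟨F₃, hF₃, h3⟩ := deriv_eventuallyEq_of_remainder (n := 1)
    (Q' := fun _ => d * (3 * 2))
    (fun z => by
      simpa using ((((hx z).const_mul 2).const_mul 3).const_mul d).const_add (c * 2)) hF₂ h2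
  refine ⟨by simpa using h0, by simpa using h1.self_of_nhds, ?_, ?_⟩
  · rw [iteratedDeriv_succ, iteratedDeriv_one, h2.self_of_nhds]
    ring
  · rw [iteratedDeriv_succ, iteratedDeriv_succ, iteratedDeriv_one, h3.self_of_nhds]
    ring

lemma HasJet.unique {f : ℂ → ℂ} {p a b c d a' b' c' d' : ℂ} (h : HasJet f p a b c d)
    (h' : HasJet f p a' b' c' d') : a = a' ∧ b = b' ∧ c = c' ∧ d = d' := by
  obtain ⟨h0, h1, h2, h3⟩ := h.derivs
  obtain ⟨h0', h1', h2', h3'⟩ := h'.derivs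
  refine ⟨h0 ▸ h0', h1 ▸ h1', ?_, ?_⟩
  · have : (2 : ℂ) * c = 2 * c' := h2 ▸ h2'
    linear_combination this / 2
  · have : (6 : ℂ) * d = 6 * d' := h3 ▸ h3'
    linear_combination this / 6

/-- The recursion for the Taylor coefficients of `T a ∘ v` when `v p = 0`. -/
lemma HasJet.T_comp {v : ℂ → ℂ} {p a v₁ v₂ v₃ : ℂ} (hv : HasJet v p 0 v₁ v₂ v₃)
    (hT : AnalyticAt ℂ (fun z => T a (v z)) p) (hne : ∀ᶠ z in 𝓝 p, 1 + conj a * v z ≠ 0) :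
    ∃ g₁ g₂ g₃, HasJet (fun z => T a (v z)) p a g₁ g₂ g₃ ∧ g₁ = (1 - a * conj a) * v₁ ∧
      g₂ = (1 - a * conj a) * v₂ - conj a * v₁ * g₁ ∧
      g₃ = (1 - a * conj a) * v₃ - conj a * (v₁ * g₂ + v₂ * g₁) := by
  obtain ⟨g₀, g₁, g₂, g₃, hg⟩ := exists_hasJet hT
  have h1 := hg.mul ((hasJet_const p 1).add ((hasJet_const p (conj a)).mul hv))
  have h2 := (hv.add (hasJet_const p a)).congr
    (g := fun z => T a (v z) * (1 + conj a * v z)) (by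
      filter_upwards [hne] with z hz
      rw [T, div_mul_cancel₀ _ hz])
  obtain ⟨e0, e1, e2, e3⟩ := h1.unique h2
  have e0' : g₀ = a := by linear_combination e0
  subst e0'
  exact ⟨g₁, g₂, g₃, hg, by linear_combination e1, by linear_combination e2,
    by linear_combination e3⟩

lemma hasJet_T_neg {r : ℝ} (h0 : 0 < r) (hr : r < 1) :
    HasJet (T (-r)) r 0 (1 / (1 - r ^ 2)) (r / (1 - r ^ 2) ^ 2) (r ^ 2 / (1 - r ^ 2) ^ 3) := by
  have hr1 : ‖(r : ℂ)‖ < 1 := norm_ofReal_lt_one h0 hr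
  have hr2 : ‖-(r : ℂ)‖ < 1 := by rwa [norm_neg]
  have hmem : ball (0 : ℂ) 1 ∈ 𝓝 (r : ℂ) := isOpen_ball.mem_nhds (mem_ball_zero_iff.2 hr1)
  obtain ⟨a, b, c, d, h⟩ := exists_hasJet ((differentiableOn_T hr2).analyticAt hmem)
  have h1 := h.mul ((hasJet_const r 1).add ((hasJet_const r (conj (-r : ℂ))).mul (hasJet_id r)))
  have h2 := ((hasJet_id r).add (hasJet_const r (-r))).congr
    (g := fun z => T (-r) z * (1 + conj (-r : ℂ) * z)) (by
      filter_upwards [hmem] with z hz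
      rw [T, div_mul_cancel₀ _ (one_add_conj_mul_ne_zero hr2 (mem_ball_zero_iff.1 hz).le)])
  obtain ⟨e0, e1, e2, e3⟩ := h1.unique h2
  have hq : (1 - (r : ℂ) ^ 2) ≠ 0 := by
    norm_cast; nlinarith
  simp only [map_neg, conj_ofReal] at e0 e1 e2 e3
  have f0 : a = 0 := by
    apply mul_right_cancel₀ hq; linear_combination e0
  subst f0
  have f1 : b = 1 / (1 - r ^ 2) := by
    rw [eq_div_iff hq]; linear_combination e1
  have f2 : c = r / (1 - r ^ 2) ^ 2 := by
    have : c * (1 - r ^ 2) = b * r := by linear_combination e2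
    rw [eq_div_iff (pow_ne_zero _ hq), pow_two, ← mul_assoc, this, f1]
    field_simp
  have f3 : d = r ^ 2 / (1 - r ^ 2) ^ 3 := by
    have : d * (1 - r ^ 2) = c * r := by linear_combination e3
    rw [eq_div_iff (pow_ne_zero _ hq), pow_succ' _ 2, ← mul_assoc, this, f2]
    field_simp
  rw [← f1, ← f2, ← f3]
  exact h

lemma denominator_ne_zero {r s : ℝ} (hs : 0 ≤ s) (hsr : s < r) {lam : ℂ}
    (hlam : ‖lam‖ < 1) : (1 + r ^ 2 - 2 * s * lam : ℂ) ≠ 0 := by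
  intro h
  have h1 : (2 * s * lam : ℂ) = ((1 + r ^ 2 : ℝ) : ℂ) := by push_cast; linear_combination -h
  have h2 := congrArg norm h1
  rw [norm_mul, norm_mul, norm_real, norm_real, Real.norm_eq_abs, Real.norm_eq_abs,
    abs_of_nonneg hs, abs_of_pos (by positivity), Complex.norm_ofNat] at h2
  nlinarith [sq_nonneg (r - 1), mul_le_of_le_one_right hs hlam.le]

lemma deriv_schurExtension {r s : ℝ} (hs : 0 ≤ s) (hsr : s < r) (hr : r < 1) {lam : ℂ}
    (hlam : ‖lam‖ < 1) {k : ℂ → ℂ} (hk : IsSchur k) :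
    schurExtension r s lam k r = s ∧ deriv (schurExtension r s lam k) r = w₁ r s lam ∧
    iteratedDeriv 3 (schurExtension r s lam k) r = coefA r s * (coefB r s lam +
      coefC r s lam * cen (eta r s lam) (k r) +
      r ^ 2 * (1 - (‖lam‖ : ℂ) ^ 2) * (1 - r ^ 2) * deriv k r) := by
  have h0 : 0 < r := hs.trans_lt hsr
  have hσ := norm_div_lt_one hs hsr
  have hr1 : ‖(r : ℂ)‖ < 1 := norm_ofReal_lt_one h0 hr
  have hmem : ball (0 : ℂ) 1 ∈ 𝓝 (r : ℂ) := isOpen_ball.mem_nhds (mem_ball_zero_iff.2 hr1)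
  have hu : IsSchur (T (-r)) := isSchur_T (by rwa [norm_neg])
  have hh := hk.inner h0 hr hlam
  have hg := hh.inner h0 hr hσ
  obtain ⟨k₀, k₁, k₂, k₃, jk⟩ := exists_hasJet (hk.diff.analyticAt hmem)
  obtain ⟨ek₀, ek₁, -, -⟩ := jk.derivs
  have ju := hasJet_T_neg h0 hr
  have juk := ju.mul jk
  simp only [zero_mul, zero_add] at juk
  obtain ⟨h₁, h₂, h₃, jh, eh₁, eh₂, -⟩ := juk.T_comp (hh.diff.analyticAt hmem) (by
    filter_upwards [hmem] with z hz
    exact one_add_conj_mul_ne_zero hlam ((hu.mul hk).norm_le z hz))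
  have jv := ju.mul jh
  simp only [zero_mul, zero_add] at jv
  obtain ⟨g₁, g₂, g₃, jg, eg₁, eg₂, eg₃⟩ := jv.T_comp (hg.diff.analyticAt hmem) (by
    filter_upwards [hmem] with z hz
    exact one_add_conj_mul_ne_zero hσ ((hu.mul hh).norm_le z hz))
  have jf : HasJet (schurExtension r s lam k) r _ _ _ _ := (hasJet_id r).mul jg
  obtain ⟨f0, f1, -, f3⟩ := jf.derivs
  have hrc : (r : ℂ) ≠ 0 := by exact_mod_cast h0.ne'
  have hq : (1 - (r : ℂ) ^ 2) ≠ 0 := by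
    norm_cast; nlinarith
  have hW := denominator_ne_zero hs hsr hlam
  have hl : (‖lam‖ : ℂ) ^ 2 = lam * conj lam := (mul_conj' lam).symm
  have hη : coefC r s lam * cen (eta r s lam) (k r) = r * (1 - lam * conj lam) *
      ((1 + r ^ 2 - 2 * s * lam) * k₀ - r * conj lam * k₀ ^ 2) := by
    have he : eta r s lam * (1 + r ^ 2 - 2 * s * lam) = r * conj lam := by
      rw [eta, div_mul_cancel₀ _ hW]
    rw [coefC, cen, ek₀, hl]
    linear_combination (-(r : ℂ) * (1 - lam * conj lam) * k₀ ^ 2) * he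
  have hconj : conj (s / r : ℂ) = s / r := by simp
  rw [hconj] at eg₁ eg₂ eg₃
  refine ⟨?_, ?_, ?_⟩
  · rw [f0]; field_simp
  · rw [f1, eg₁, w₁]
    field_simp
    ring
  · rw [f3, hη, ek₁, hl, coefA, coefB, eg₃, eg₂, eg₁, eh₂, eh₁]
    push_cast
    field_simp
    ring

lemma IsBlaschkeProduct.congr {n : ℕ} {f g : ℂ → ℂ} (hf : IsBlaschkeProduct n f)
    (h : EqOn g f (ball 0 1)) : IsBlaschkeProduct n g := by
  obtain ⟨φ, a, ha, hf⟩ := hf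
  exact ⟨φ, a, ha, fun z hz => (h hz).trans (hf z hz)⟩

lemma isBlaschkeProduct_const {c : ℂ} (hc : ‖c‖ = 1) : IsBlaschkeProduct 0 fun _ => c := by
  refine ⟨arg c, Fin.elim0, fun j => j.elim0, fun z _ => ?_⟩
  have := norm_mul_exp_arg_mul_I c
  rw [hc, ofReal_one, one_mul] at this
  simp [this]

lemma IsBlaschkeProduct.T_mul {n : ℕ} {f : ℂ → ℂ} {a : ℂ} (ha : ‖a‖ < 1)
    (hf : IsBlaschkeProduct n f) : IsBlaschkeProduct (n + 1) fun z => T (-a) z * f z := by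
  obtain ⟨φ, b, hb, hf⟩ := hf
  refine ⟨φ, Fin.cons a b, Fin.cases (by simpa) (by simpa), fun z hz => ?_⟩
  simp only [hf z hz, Fin.prod_univ_succ, Fin.cons_zero, Fin.cons_succ, T, map_neg, neg_mul,
    ← sub_eq_add_neg]
  ring

lemma exists_fin_eq_multiset (s : Multiset ℂ) :
    ∀ n, s.card = n → ∃ b : Fin n → ℂ, Finset.univ.val.map b = s := by
  rintro n rfl
  refine ⟨fun i => s.toList.get (i.cast (by simp)), ?_⟩
  rw [Fin.univ_val_map]
  conv_rhs => rw [← s.coe_toList, ← List.ofFn_get s.toList]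
  congr 1
  exact (List.ofFn_congr (by simp) _).symm

lemma norm_one_sub_conj_mul_le {a b : ℂ} (ha : ‖a‖ < 1) (hb : 1 ≤ ‖b‖) :
    ‖1 - conj a * b‖ ≤ ‖b - a‖ := by
  have h : ‖b - a‖ ^ 2 - ‖1 - conj a * b‖ ^ 2 = (1 - ‖a‖ ^ 2) * (‖b‖ ^ 2 - 1) := by
    simp only [Complex.sq_norm, Complex.normSq_apply, sub_re, sub_im, mul_re, mul_im, conj_re,
      conj_im, one_re, one_im]
    ring
  have h1 : 0 ≤ (1 - ‖a‖ ^ 2) * (‖b‖ ^ 2 - 1) :=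
    mul_nonneg (by nlinarith [norm_nonneg a]) (by nlinarith)
  exact (sq_le_sq₀ (norm_nonneg _) (norm_nonneg _)).1 (by linarith)

lemma prod_reflect {n : ℕ} (b : Fin n → ℂ) {z : ℂ} (hz : z ≠ 0) :
    conj (∏ j, ((conj z)⁻¹ - b j)) * z ^ n = ∏ j, (1 - conj (b j) * z) := by
  have : z ^ n = ∏ _j : Fin n, z := by simp
  rw [map_prod, this, ← Finset.prod_mul_distrib]
  refine Finset.prod_congr rfl fun j _ => ?_
  simp only [map_sub, map_inv₀, conj_conj]
  field_simp

lemma prod_reflect' {n : ℕ} (b : Fin n → ℂ) {z : ℂ} (hz : z ≠ 0) :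
    conj (∏ j, (1 - conj (b j) * (conj z)⁻¹)) * z ^ n = ∏ j, (z - b j) := by
  have : z ^ n = ∏ _j : Fin n, z := by simp
  rw [map_prod, this, ← Finset.prod_mul_distrib]
  refine Finset.prod_congr rfl fun j _ => ?_
  simp only [map_sub, map_mul, map_one, map_inv₀, conj_conj]
  field_simp

lemma exists_factorization {n : ℕ} {a : Fin n → ℂ} (ha : ∀ j, ‖a j‖ < 1) {α c : ℂ}
    (hα : ‖α‖ < 1) (hc : ‖c‖ = 1) : ∃ (L : ℂ) (b : Fin n → ℂ), L ≠ 0 ∧ (∀ j, ‖b j‖ < 1) ∧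
      ∀ z, c * ∏ j, (z - a j) + α * ∏ j, (1 - conj (a j) * z) = L * ∏ j, (z - b j) := by
  open Polynomial in
  set N : ℂ[X] := C c * ∏ j, (X - C (a j)) + C α * ∏ j, (1 - C (conj (a j)) * X) with hN
  have heval : ∀ z, N.eval z = c * ∏ j, (z - a j) + α * ∏ j, (1 - conj (a j) * z) := fun z => by
    simp [hN, Polynomial.eval_prod]
  have hd1 : ∀ j, (X - C (a j)).natDegree ≤ 1 := fun j => (natDegree_X_sub_C _).le
  have hd2 : ∀ j, (1 - C (conj (a j)) * X).natDegree ≤ 1 := fun j => by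
    compute_degree
  have hcoeff : N.coeff n = c + α * ∏ j, (-conj (a j)) := by
    have h1 := coeff_prod_of_natDegree_le Finset.univ (fun j => X - C (a j)) 1 fun j _ => hd1 j
    have h2 := coeff_prod_of_natDegree_le Finset.univ (fun j => 1 - C (conj (a j)) * X) 1
      fun j _ => hd2 j
    simp only [Finset.card_univ, Fintype.card_fin, mul_one, coeff_sub, coeff_X_one, coeff_C_mul,
      coeff_C_succ, coeff_one, sub_zero, Finset.prod_const_one] at h1 h2
    rw [hN, coeff_add, coeff_C_mul, coeff_C_mul, h1, h2]
    simp
  have hne : N.coeff n ≠ 0 := by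
    rw [hcoeff]
    intro h
    have h1 : c = -(α * ∏ j, (-conj (a j))) := by linear_combination h
    have h2 := congrArg norm h1
    rw [hc, norm_neg, norm_mul, norm_prod] at h2
    have h3 : ∏ j, ‖-conj (a j)‖ ≤ 1 :=
      Finset.prod_le_one (fun j _ => norm_nonneg _) fun j _ => by simpa using (ha j).le
    have h4 : 0 ≤ ∏ j, ‖-conj (a j)‖ := Finset.prod_nonneg fun j _ => norm_nonneg _
    nlinarith [norm_nonneg α]
  have hdeg : N.natDegree = n := by
    refine le_antisymm ?_ (le_natDegree_of_ne_zero hne)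
    have hp : ∀ f : Fin n → ℂ[X], (∀ j, (f j).natDegree ≤ 1) → (∏ j, f j).natDegree ≤ n :=
      fun f hf => (natDegree_prod_le _ _).trans
        ((Finset.sum_le_sum fun j _ => hf j).trans (by simp))
    exact natDegree_add_le_of_degree_le ((natDegree_C_mul_le _ _).trans (hp _ hd1))
      ((natDegree_C_mul_le _ _).trans (hp _ hd2))
  have hsplit := IsAlgClosed.splits N
  have hcard : N.roots.card = n := by rw [← hsplit.natDegree_eq_card_roots, hdeg]
  obtain ⟨b, hb⟩ := exists_fin_eq_multiset _ n hcard
  have hN0 : N ≠ 0 := by rintro h; rw [h] at hne; simp at hne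
  refine ⟨N.leadingCoeff, b, leadingCoeff_ne_zero.2 hN0, fun j => ?_, fun z => ?_⟩
  · have hroot : N.eval (b j) = 0 := by
      have : b j ∈ N.roots := by
        rw [← hb]; exact Multiset.mem_map_of_mem _ (Finset.mem_univ_val j)
      exact (mem_roots hN0).1 this
    by_contra hbj
    rw [not_lt] at hbj
    rw [heval] at hroot
    have h1 : c * ∏ i, (b j - a i) = -(α * ∏ i, (1 - conj (a i) * b j)) := by
      linear_combination hroot
    have h2 := congrArg norm h1
    rw [norm_neg, norm_mul, norm_mul, hc, one_mul, norm_prod, norm_prod] at h2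
    have h3 : ∏ i, ‖1 - conj (a i) * b j‖ ≤ ∏ i, ‖b j - a i‖ :=
      Finset.prod_le_prod (fun i _ => norm_nonneg _)
        fun i _ => norm_one_sub_conj_mul_le (ha i) hbj
    have h4 : 0 < ∏ i, ‖b j - a i‖ := Finset.prod_pos fun i _ => by
      rw [norm_pos_iff, sub_ne_zero]
      rintro h
      rw [h] at hbj
      exact (ha i).not_ge hbj
    have h5 : 0 ≤ ∏ i, ‖1 - conj (a i) * b j‖ := Finset.prod_nonneg fun i _ => norm_nonneg _
    nlinarith [norm_nonneg α]
  · rw [← heval]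
    have hprod : N = C N.leadingCoeff * ∏ j, (X - C (b j)) := by
      conv_lhs => rw [hsplit.eq_prod_roots, ← hb, Multiset.map_map]
      rfl
    conv_lhs => rw [hprod]
    simp [Polynomial.eval_prod]

lemma IsBlaschkeProduct.T_comp {n : ℕ} {f : ℂ → ℂ} {α : ℂ} (hα : ‖α‖ < 1)
    (hf : IsBlaschkeProduct n f) : IsBlaschkeProduct n fun z => T α (f z) := by
  obtain ⟨φ, a, ha, hf⟩ := hf
  set c := exp (φ * I) with hcdef
  have hc : ‖c‖ = 1 := norm_exp_ofReal_mul_I φ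
  have hcc : c * conj c = 1 := by rw [mul_conj']; simp [hc]
  have hc0 : c ≠ 0 := by rintro h; simp [h] at hc
  obtain ⟨L, b, hL, hb, hfac⟩ := exists_factorization ha hα hc
  have hrefl : ∀ z, ∏ j, (1 - conj (a j) * z) + conj α * (c * ∏ j, (z - a j)) =
      c * conj L * ∏ j, (1 - conj (b j) * z) := by
    have hcont1 : Continuous fun z : ℂ => ∏ j, (1 - conj (a j) * z) +
        conj α * (c * ∏ j, (z - a j)) := by fun_prop
    have hcont2 : Continuous fun z : ℂ => c * conj L * ∏ j, (1 - conj (b j) * z) := by fun_prop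
    refine congrFun (Continuous.ext_on (dense_compl_singleton (0 : ℂ)) hcont1 hcont2 ?_)
    intro z hz
    have hz0 : z ≠ 0 := hz
    have h := congrArg (fun w => conj w * z ^ n) (hfac (conj z)⁻¹)
    simp only [map_add, map_mul, add_mul, mul_assoc] at h
    rw [prod_reflect a hz0, prod_reflect' a hz0, prod_reflect b hz0] at h
    linear_combination c * h - (∏ j, (1 - conj (a j) * z)) * hcc
  have hLn : ‖L / (c * conj L)‖ = 1 := by
    rw [norm_div, norm_mul, hc, RCLike.norm_conj, one_mul, div_self (norm_ne_zero_iff.2 hL)]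
  refine ⟨arg (L / (c * conj L)), b, hb, fun z hz => ?_⟩
  have hexp := norm_mul_exp_arg_mul_I (L / (c * conj L))
  rw [hLn, ofReal_one, one_mul] at hexp
  have hz1 := (mem_ball_zero_iff.1 hz).le
  have hprod : ∀ b : Fin n → ℂ, (∀ j, ‖b j‖ < 1) → ∏ j, (1 - conj (b j) * z) ≠ 0 := fun b hb =>
    Finset.prod_ne_zero_iff.2 fun j _ => by
      have := one_add_conj_mul_ne_zero (a := -b j) (by simpa using hb j) hz1
      simpa [sub_eq_add_neg] using this
  have hq := hprod a ha
  have hq' := hprod b hb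
  have hL' : conj L ≠ 0 := (map_ne_zero _).2 hL
  have h1 := hfac z
  have h2 := hrefl z
  beta_reduce
  rw [hexp, hf z hz, Finset.prod_div_distrib, Finset.prod_div_distrib]
  set p := ∏ j, (z - a j)
  set q := ∏ j, (1 - conj (a j) * z)
  set p' := ∏ j, (z - b j)
  set q' := ∏ j, (1 - conj (b j) * z)
  have e1 : c * (p / q) + α = L * p' / q := by rw [← h1]; field_simp
  have e2 : 1 + conj α * (c * (p / q)) = c * conj L * q' / q := by rw [← h2]; field_simp
  rw [T, e1, e2]
  field_simp

lemma isBlaschkeProduct_schurExtension {n : ℕ} {r s : ℝ} (hs : 0 ≤ s) (hsr : s < r) (hr : r < 1)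
    {lam : ℂ} (hlam : ‖lam‖ < 1) {k : ℂ → ℂ} (hk : IsBlaschkeProduct n k) :
    IsBlaschkeProduct (n + 3) (schurExtension r s lam k) := by
  have hr1 := norm_ofReal_lt_one (hs.trans_lt hsr) hr
  have h := ((((hk.T_mul hr1).T_comp hlam).T_mul hr1).T_comp (norm_div_lt_one hs hsr)).T_mul
    (a := 0) (by simp)
  refine h.congr fun z _ => ?_
  simp [schurExtension, T]

lemma ofReal_mem_ball {r : ℝ} (h0 : 0 < r) (hr : r < 1) : (r : ℂ) ∈ ball (0 : ℂ) 1 :=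
  mem_ball_zero_iff.2 (norm_ofReal_lt_one h0 hr)

lemma isSchur_T_neg {r : ℝ} (h0 : 0 < r) (hr : r < 1) : IsSchur (T (-r)) :=
  isSchur_T (by rw [norm_neg]; exact norm_ofReal_lt_one h0 hr)

/-- The derivative at `r` of `T a (T (-r) z * m z)`. -/
lemma deriv_T_comp_T_neg_mul {r : ℝ} (h0 : 0 < r) (hr : r < 1) {a : ℂ} (ha : ‖a‖ < 1)
    {m : ℂ → ℂ} (hm : IsSchur m) :
    deriv (fun z => T a (T (-r) z * m z)) r = (1 - (‖a‖ : ℂ) ^ 2) / (1 - r ^ 2) * m r := by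
  have hmem : ball (0 : ℂ) 1 ∈ 𝓝 (r : ℂ) := isOpen_ball.mem_nhds (ofReal_mem_ball h0 hr)
  obtain ⟨m₀, m₁, m₂, m₃, jm⟩ := exists_hasJet (hm.diff.analyticAt hmem)
  have jv := (hasJet_T_neg h0 hr).mul jm
  simp only [zero_mul, zero_add] at jv
  obtain ⟨g₁, g₂, g₃, jg, e, -⟩ := jv.T_comp ((hm.inner h0 hr ha).diff.analyticAt hmem) (by
    filter_upwards [hmem] with z hz
    exact one_add_conj_mul_ne_zero ha (((isSchur_T_neg h0 hr).mul hm).norm_le z hz))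
  rw [jg.derivs.2.1, e, jm.derivs.1, mul_conj']
  ring

lemma IsSchur.congr {f g : ℂ → ℂ} (hf : IsSchur f) (h : EqOn g f (ball 0 1)) : IsSchur g :=
  ⟨hf.diff.congr h, fun z hz => by rw [h hz]; exact hf.norm_le z hz⟩

lemma exists_eqOn_schurExtension {r s : ℝ} (hs : 0 ≤ s) (hsr : s < r) (hr : r < 1) {lam : ℂ}
    (hlam : ‖lam‖ < 1) {f : ℂ → ℂ} (hf : f ∈ classH0 r s lam) :
    ∃ k, IsSchur k ∧ EqOn f (schurExtension r s lam k) (ball 0 1) := by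
  have h0 : 0 < r := hs.trans_lt hsr
  have hrc : (r : ℂ) ≠ 0 := by exact_mod_cast h0.ne'
  have hrm := ofReal_mem_ball h0 hr
  have hmem : ball (0 : ℂ) 1 ∈ 𝓝 (r : ℂ) := isOpen_ball.mem_nhds hrm
  have hr1 := norm_ofReal_lt_one h0 hr
  have hσ := norm_div_lt_one hs hsr
  obtain ⟨hH, hfr, hfd⟩ := hf
  have hfS : IsSchur f := ⟨hH.analytic, fun z hz => (mem_ball_zero_iff.1 (hH.mapsTo hz)).le⟩
  obtain ⟨g, hg, hfg⟩ := hfS.exists_factor (p := 0) (by simp) (by simp [hH.map_zero])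
  have hfg' : ∀ z ∈ ball (0 : ℂ) 1, f z = z * g z := fun z hz => by
    rw [hfg z hz, hH.map_zero]; simp [T]
  have hgr : g r = s / r := by
    rw [eq_div_iff hrc, mul_comm, ← hfg' r hrm, hfr]
  obtain ⟨h, hh, hgh⟩ := hg.exists_factor hr1 (by rwa [hgr])
  rw [hgr] at hgh
  have hgd : deriv g r = (1 - (‖(s / r : ℂ)‖ : ℂ) ^ 2) / (1 - r ^ 2) * h r := by
    rw [← deriv_T_comp_T_neg_mul h0 hr hσ hh]
    apply Filter.EventuallyEq.deriv_eq
    filter_upwards [hmem] with z hz using hgh z hz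
  have hhr : h r = lam := by
    have h1 : deriv f r = g r + r * deriv g r := by
      have h2 : deriv f r = deriv (fun z => z * g z) r := by
        apply Filter.EventuallyEq.deriv_eq
        filter_upwards [hmem] with z hz using hfg' z hz
      have h3 := (hasDerivAt_id (r : ℂ)).fun_mul ((hg.diff.differentiableAt hmem).hasDerivAt)
      rw [h2]
      refine h3.deriv.trans ?_
      simp
    rw [hfd, w₁, hgr, hgd, ← mul_conj'] at h1
    have hconj : conj (s / r : ℂ) = s / r := by simp
    have hq : (1 - (r : ℂ) ^ 2) ≠ 0 := by norm_cast; nlinarith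
    have hd : ((r : ℂ) ^ 2 - s ^ 2) ≠ 0 := by norm_cast; nlinarith
    rw [hconj] at h1
    field_simp at h1
    have h4 : ((r : ℂ) ^ 2 - s ^ 2) * h r = (r ^ 2 - s ^ 2) * lam := by linear_combination -h1
    exact mul_left_cancel₀ hd h4
  obtain ⟨k, hk, hhk⟩ := hh.exists_factor hr1 (by rwa [hhr])
  rw [hhr] at hhk
  refine ⟨k, hk, fun z hz => ?_⟩
  rw [hfg' z hz, hgh z hz, hhk z hz, schurExtension]

lemma mem_classH0_of_eqOn {r s : ℝ} (hs : 0 ≤ s) (hsr : s < r) (hr : r < 1) {lam : ℂ}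
    (hlam : ‖lam‖ < 1) {k f : ℂ → ℂ} (hk : IsSchur k)
    (hf : EqOn f (schurExtension r s lam k) (ball 0 1)) : f ∈ classH0 r s lam := by
  have h0 : 0 < r := hs.trans_lt hsr
  have hrm := ofReal_mem_ball h0 hr
  have hH := schurExtension_memH0 hs hsr hr hlam hk
  obtain ⟨h1, h2, -⟩ := deriv_schurExtension hs hsr hr hlam hk
  refine ⟨⟨hH.analytic.congr hf, fun z hz => ?_, ?_⟩, ?_, ?_⟩
  · rw [hf hz]; exact hH.mapsTo hz
  · rw [hf (mem_ball_self one_pos)]; exact hH.map_zero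
  · rw [hf hrm, h1]
  · rw [← h2]
    exact (hf.eventuallyEq_of_mem (isOpen_ball.mem_nhds hrm)).deriv_eq

lemma tpar_pos {r s : ℝ} (hs : 0 ≤ s) (hsr : s < r) {lam : ℂ} (hlam : ‖lam‖ < 1) :
    0 < tpar r s lam :=
  div_pos (hs.trans_lt hsr) (norm_pos_iff.2 (denominator_ne_zero hs hsr hlam))

lemma norm_eta_lt {r s : ℝ} (hs : 0 ≤ s) (hsr : s < r) {lam : ℂ} (hlam : ‖lam‖ < 1) :
    ‖eta r s lam‖ < tpar r s lam := by
  have h0 : 0 < r := hs.trans_lt hsr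
  have h1 : ‖eta r s lam‖ = tpar r s lam * ‖lam‖ := by
    rw [eta, tpar, norm_div, norm_mul, norm_real, Real.norm_eq_abs, abs_of_pos h0,
      RCLike.norm_conj]
    ring
  rw [h1]
  exact mul_lt_of_lt_one_right (tpar_pos hs hsr hlam) hlam

lemma coefC_ne_zero {r s : ℝ} (hs : 0 ≤ s) (hsr : s < r) {lam : ℂ} (hlam : ‖lam‖ < 1) :
    coefC r s lam ≠ 0 := by
  have h0 : 0 < r := hs.trans_lt hsr
  have h1 : (1 - (‖lam‖ : ℂ) ^ 2) ≠ 0 := by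
    norm_cast
    nlinarith [norm_nonneg lam]
  exact mul_ne_zero (mul_ne_zero (by exact_mod_cast h0.ne') h1) (denominator_ne_zero hs hsr hlam)

lemma coefA_pos {r s : ℝ} (hs : 0 ≤ s) (hsr : s < r) (hr : r < 1) : 0 < coefA r s := by
  have h0 : 0 < r := hs.trans_lt hsr
  have h1 : 0 < r ^ 2 - s ^ 2 := by nlinarith
  have h2 : 0 < 1 - r ^ 2 := by nlinarith
  unfold coefA
  positivity

lemma coefC_mul_tpar {r s : ℝ} (hs : 0 ≤ s) (hsr : s < r) {lam : ℂ} (hlam : ‖lam‖ < 1) :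
    coefC r s lam * tpar r s lam =
      r ^ 2 * (1 - (‖lam‖ : ℂ) ^ 2) * exp (arg (coefC r s lam) * I) := by
  have h0 : 0 < r := hs.trans_lt hsr
  have hW := norm_ne_zero_iff.2 (denominator_ne_zero hs hsr hlam)
  have hWc : (‖(1 + r ^ 2 - 2 * s * lam : ℂ)‖ : ℂ) ≠ 0 := by exact_mod_cast hW
  have h1 : ‖coefC r s lam‖ = r * (1 - ‖lam‖ ^ 2) * ‖(1 + r ^ 2 - 2 * s * lam : ℂ)‖ := by
    have : (1 - (‖lam‖ : ℂ) ^ 2) = ((1 - ‖lam‖ ^ 2 : ℝ) : ℂ) := by push_cast; ring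
    rw [coefC, this, norm_mul, norm_mul, norm_real, norm_real, Real.norm_eq_abs, Real.norm_eq_abs,
      abs_of_pos h0, abs_of_nonneg (by nlinarith [norm_nonneg lam])]
  conv_lhs => rw [← norm_mul_exp_arg_mul_I (coefC r s lam), h1, tpar]
  push_cast
  field_simp

/-- The normalized derivative at `r`, rotated by the argument of `coefC r s lam`. -/
noncomputable def rotatedDeriv (r s : ℝ) (lam : ℂ) (k : ℂ → ℂ) : ℂ :=
  conj (exp (arg (coefC r s lam) * I)) * (1 - r ^ 2) * deriv k r

lemma exp_mul_conj_exp (x : ℝ) : exp (x * I) * conj (exp (x * I)) = 1 := by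
  rw [mul_conj', norm_exp_ofReal_mul_I]; simp

lemma iteratedDeriv_eq_of_eqOn {r s : ℝ} (hs : 0 ≤ s) (hsr : s < r) (hr : r < 1) {lam : ℂ}
    (hlam : ‖lam‖ < 1) {k f : ℂ → ℂ} (hk : IsSchur k)
    (hf : EqOn f (schurExtension r s lam k) (ball 0 1)) :
    iteratedDeriv 3 f r = coefA r s * (coefB r s lam + coefC r s lam *
      (cen (eta r s lam) (k r) + tpar r s lam * rotatedDeriv r s lam k)) := by
  have h0 : 0 < r := hs.trans_lt hsr
  rw [(hf.eventuallyEq_of_mem (isOpen_ball.mem_nhds (ofReal_mem_ball h0 hr))).iteratedDeriv_eq 3,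
    (deriv_schurExtension hs hsr hr hlam hk).2.2, mul_add (coefC r s lam),
    ← mul_assoc _ (tpar r s lam : ℂ),
    coefC_mul_tpar hs hsr hlam, rotatedDeriv]
  linear_combination (-coefA r s * r ^ 2 * (1 - (‖lam‖ : ℂ) ^ 2) * (1 - r ^ 2) * deriv k r : ℂ) *
    exp_mul_conj_exp (arg (coefC r s lam))

lemma one_sub_sq_ne_zero {r : ℝ} (h0 : 0 < r) (hr : r < 1) : (1 - (r : ℂ) ^ 2) ≠ 0 := by
  norm_cast; nlinarith

lemma rotatedDeriv_T {r s : ℝ} (h0 : 0 < r) (hr : r < 1) {lam a : ℂ} (ha : ‖a‖ < 1)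
    {k m : ℂ → ℂ} (hm : IsSchur m)
    (hk : ∀ z ∈ ball (0 : ℂ) 1, k z = T a (T (-r) z * m z)) :
    rotatedDeriv r s lam k =
      (1 - ‖a‖ ^ 2 : ℝ) * (conj (exp (arg (coefC r s lam) * I)) * m r) := by
  have h1 : deriv k r = deriv (fun z => T a (T (-r) z * m z)) r := by
    apply Filter.EventuallyEq.deriv_eq
    filter_upwards [isOpen_ball.mem_nhds (ofReal_mem_ball h0 hr)] with z hz using hk z hz
  have hq := one_sub_sq_ne_zero h0 hr
  rw [rotatedDeriv, h1, deriv_T_comp_T_neg_mul h0 hr ha hm]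
  push_cast
  field_simp

lemma rotatedDeriv_of_norm_eq_one {r s : ℝ} (h0 : 0 < r) (hr : r < 1) {lam : ℂ}
    {k : ℂ → ℂ} (hk : IsSchur k) (h : ‖k r‖ = 1) : rotatedDeriv r s lam k = 0 := by
  have h1 : deriv k r = deriv (fun _ : ℂ => k r) r := by
    apply Filter.EventuallyEq.deriv_eq
    filter_upwards [isOpen_ball.mem_nhds (ofReal_mem_ball h0 hr)] with z hz
    exact hk.eqOn_const (ofReal_mem_ball h0 hr) h z hz
  rw [rotatedDeriv, h1, deriv_const, mul_zero]

lemma norm_conj_exp_mul (x : ℝ) (w : ℂ) : ‖conj (exp (x * I)) * w‖ = ‖w‖ := by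
  rw [norm_mul, RCLike.norm_conj, norm_exp_ofReal_mul_I, one_mul]

lemma norm_rotatedDeriv_le {r s : ℝ} (h0 : 0 < r) (hr : r < 1) {lam : ℂ}
    {k : ℂ → ℂ} (hk : IsSchur k) : ‖rotatedDeriv r s lam k‖ ≤ 1 - ‖k r‖ ^ 2 := by
  have hrm := ofReal_mem_ball h0 hr
  rcases (hk.norm_le r hrm).eq_or_lt with h | h
  · rw [rotatedDeriv_of_norm_eq_one h0 hr hk h, h]; simp
  · obtain ⟨m, hm, hkm⟩ := hk.exists_factor (norm_ofReal_lt_one h0 hr) h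
    have h1 : 0 ≤ 1 - ‖k r‖ ^ 2 := by nlinarith [norm_nonneg (k r)]
    rw [rotatedDeriv_T h0 hr h hm hkm, norm_mul, norm_conj_exp_mul, norm_real, Real.norm_eq_abs,
      abs_of_nonneg h1]
    exact mul_le_of_le_one_right h1 (hm.norm_le r hrm)

lemma T_comp_T_neg_mul_apply_self (r : ℝ) (a : ℂ) (m : ℂ → ℂ) : T a (T (-r) r * m r) = a := by
  simp

lemma exists_isSchur_of_norm_le {r : ℝ} (s : ℝ) (h0 : 0 < r) (hr : r < 1) (lam : ℂ) {ζ β : ℂ}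
    (h : ‖β‖ ≤ 1 - ‖ζ‖ ^ 2) : ∃ k, IsSchur k ∧ k r = ζ ∧ rotatedDeriv r s lam k = β := by
  rcases (norm_le_one_of_norm_le h).eq_or_lt with h1 | h1
  · refine ⟨fun _ => ζ, isSchur_const h1.le, rfl, ?_⟩
    rw [rotatedDeriv_of_norm_eq_one h0 hr (isSchur_const h1.le) h1]
    rw [h1] at h
    exact (norm_le_zero_iff.1 (by linarith)).symm
  · have hd : 0 < 1 - ‖ζ‖ ^ 2 := by nlinarith [norm_nonneg ζ]
    have hdc : ((1 - ‖ζ‖ ^ 2 : ℝ) : ℂ) ≠ 0 := by exact_mod_cast hd.ne'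
    set m₀ : ℂ := exp (arg (coefC r s lam) * I) * β / (1 - ‖ζ‖ ^ 2 : ℝ) with hm₀
    have hm : ‖m₀‖ ≤ 1 := by
      rw [hm₀, norm_div, norm_mul, norm_exp_ofReal_mul_I, one_mul, norm_real, Real.norm_eq_abs,
        abs_of_pos hd]
      exact (div_le_one hd).2 h
    refine ⟨fun z => T ζ (T (-r) z * m₀), (isSchur_const hm).inner h0 hr h1,
      T_comp_T_neg_mul_apply_self r ζ fun _ => m₀, ?_⟩
    rw [rotatedDeriv_T h0 hr h1 (isSchur_const hm) fun z _ => rfl, hm₀]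
    rw [mul_div_assoc', mul_div_cancel₀ _ hdc]
    linear_combination β * exp_mul_conj_exp (arg (coefC r s lam))

/-- The affine map `w ↦ A (B + C w)` with the coefficients of the theorem. -/
noncomputable def coefAffine (r s : ℝ) (lam w : ℂ) : ℂ :=
  coefA r s * (coefB r s lam + coefC r s lam * w)

lemma region_eq_image {r s : ℝ} (hs : 0 ≤ s) (hsr : s < r) (hr : r < 1) {lam : ℂ}
    (hlam : ‖lam‖ < 1) :
    region r s lam = coefAffine r s lam '' diskUnion (eta r s lam) (tpar r s lam) := by
  have h0 : 0 < r := hs.trans_lt hsr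
  ext w
  constructor
  · rintro ⟨f, hf, rfl⟩
    obtain ⟨k, hk, hfk⟩ := exists_eqOn_schurExtension hs hsr hr hlam hf
    exact ⟨_, ⟨k r, _, norm_rotatedDeriv_le h0 hr hk, rfl⟩,
      (iteratedDeriv_eq_of_eqOn hs hsr hr hlam hk hfk).symm⟩
  · rintro ⟨_, ⟨ζ, β, hβ, rfl⟩, rfl⟩
    obtain ⟨k, hk, rfl, rfl⟩ := exists_isSchur_of_norm_le s h0 hr lam hβ
    exact ⟨schurExtension r s lam k, mem_classH0_of_eqOn hs hsr hr hlam hk fun _ _ => rfl,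
      iteratedDeriv_eq_of_eqOn hs hsr hr hlam hk fun _ _ => rfl⟩

lemma exists_homeomorph_coefAffine {r s : ℝ} (hs : 0 ≤ s) (hsr : s < r) (hr : r < 1) {lam : ℂ}
    (hlam : ‖lam‖ < 1) : ∃ e : ℂ ≃ₜ ℂ, ⇑e = coefAffine r s lam := by
  have hA : (coefA r s : ℂ) ≠ 0 := by exact_mod_cast (coefA_pos hs hsr hr).ne'
  have hC := coefC_ne_zero hs hsr hlam
  refine ⟨((Homeomorph.mulLeft₀ _ hC).trans (Homeomorph.addLeft (coefB r s lam))).trans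
    (Homeomorph.mulLeft₀ _ hA), ?_⟩
  ext w
  simp [coefAffine]

lemma Convex.coefAffine_image {K : Set ℂ} (hK : Convex ℝ K) (r s : ℝ) (lam : ℂ) :
    Convex ℝ (coefAffine r s lam '' K) := by
  rintro _ ⟨x, hx, rfl⟩ _ ⟨y, hy, rfl⟩ a b ha hb hab
  refine ⟨a • x + b • y, hK hx hy ha hb hab, ?_⟩
  have : b = 1 - a := by linarith
  subst this
  simp only [coefAffine, real_smul]
  push_cast
  ring

lemma eqOn_of_iteratedDeriv_eq {r s : ℝ} (hs : 0 ≤ s) (hsr : s < r) (hr : r < 1) {lam : ℂ}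
    (hlam : ‖lam‖ < 1) (θ : ℝ) {f : ℂ → ℂ} (hf : f ∈ classH0 r s lam)
    (h : iteratedDeriv 3 f r =
      coefAffine r s lam (supportPoint (eta r s lam) (tpar r s lam) θ)) :
    ∃ k, IsSchur k ∧ EqOn f (schurExtension r s lam k) (ball 0 1) ∧
      k r = zetaTheta (eta r s lam) (tpar r s lam) θ ∧
      rotatedDeriv r s lam k = (1 - ‖k r‖ ^ 2 : ℝ) * exp (θ * I) := by
  have h0 : 0 < r := hs.trans_lt hsr
  obtain ⟨k, hk, hfk⟩ := exists_eqOn_schurExtension hs hsr hr hlam hf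
  obtain ⟨e, he⟩ := exists_homeomorph_coefAffine hs hsr hr hlam
  have h1 := iteratedDeriv_eq_of_eqOn hs hsr hr hlam hk hfk
  rw [h] at h1
  change coefAffine r s lam _ = coefAffine r s lam _ at h1
  rw [← he] at h1
  have h2 := e.injective h1
  obtain ⟨h3, h4⟩ := (isMaximizer_zetaTheta (norm_eta_lt hs hsr hlam) θ).unique
    (norm_rotatedDeriv_le (s := s) (lam := lam) h0 hr hk) (by rw [← h2, supportPoint])
  exact ⟨k, hk, hfk, h3, by rw [h3, h4]⟩

lemma supportPoint_mem_frontier_region {r s : ℝ} (hs : 0 ≤ s) (hsr : s < r) (hr : r < 1) {lam : ℂ}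
    (hlam : ‖lam‖ < 1) (θ : ℝ) :
    coefAffine r s lam (supportPoint (eta r s lam) (tpar r s lam) θ) ∈
      frontier (region r s lam) := by
  obtain ⟨e, he⟩ := exists_homeomorph_coefAffine hs hsr hr hlam
  rw [region_eq_image hs hsr hr hlam, ← he, ← e.image_frontier]
  exact mem_image_of_mem _ (isMaximizer_zetaTheta (norm_eta_lt hs hsr hlam) θ).mem_frontier

lemma isSchur_extremal₄_parameter {r : ℝ} (h0 : 0 < r) (hr : r < 1) {ζ : ℂ} (hζ : ‖ζ‖ < 1)
    (α : ℝ) : IsSchur fun z => T ζ (T (-r) z * exp (α * I)) :=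
  (isSchur_const (norm_exp_ofReal_mul_I α).le).inner h0 hr hζ

lemma extremal₄_eq (r s : ℝ) (lam ζ : ℂ) (α : ℝ) :
    extremal₄ r s lam ζ α = schurExtension r s lam fun z => T ζ (T (-r) z * exp (α * I)) := by
  funext z
  rw [extremal₄, schurExtension, mul_comm (exp (α * I))]

lemma extremal₃_eq (r s : ℝ) (lam ζ : ℂ) :
    extremal₃ r s lam ζ = schurExtension r s lam fun _ => ζ := by
  funext z
  rw [extremal₃, schurExtension, mul_comm ζ]

lemma isBlaschkeProduct_extremal₃ {r s : ℝ} (hs : 0 ≤ s) (hsr : s < r) (hr : r < 1) {lam ζ : ℂ}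
    (hlam : ‖lam‖ < 1) (hζ : ‖ζ‖ = 1) : IsBlaschkeProduct 3 (extremal₃ r s lam ζ) := by
  rw [extremal₃_eq]
  exact isBlaschkeProduct_schurExtension hs hsr hr hlam (isBlaschkeProduct_const hζ)

lemma isBlaschkeProduct_extremal₄ {r s : ℝ} (hs : 0 ≤ s) (hsr : s < r) (hr : r < 1) {lam ζ : ℂ}
    (hlam : ‖lam‖ < 1) (hζ : ‖ζ‖ < 1) (α : ℝ) :
    IsBlaschkeProduct 4 (extremal₄ r s lam ζ α) := by
  rw [extremal₄_eq]
  exact isBlaschkeProduct_schurExtension hs hsr hr hlam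
    (((isBlaschkeProduct_const (norm_exp_ofReal_mul_I α)).T_mul
      (norm_ofReal_lt_one (hs.trans_lt hsr) hr)).T_comp hζ)

lemma extremal₄_iff {r s : ℝ} (hs : 0 ≤ s) (hsr : s < r) (hr : r < 1) {lam : ℂ}
    (hlam : ‖lam‖ < 1) (θ : ℝ) (hζ : ‖zetaTheta (eta r s lam) (tpar r s lam) θ‖ < 1) (f : ℂ → ℂ) :
    (f ∈ classH0 r s lam ∧ iteratedDeriv 3 f r =
      coefAffine r s lam (supportPoint (eta r s lam) (tpar r s lam) θ)) ↔
    EqOn f (extremal₄ r s lam (zetaTheta (eta r s lam) (tpar r s lam) θ)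
      (θ + arg (coefC r s lam))) (ball 0 1) := by
  have h0 : 0 < r := hs.trans_lt hsr
  have hrm := ofReal_mem_ball h0 hr
  have hexp : exp (((θ + arg (coefC r s lam) : ℝ) : ℂ) * I) =
      exp (θ * I) * exp (arg (coefC r s lam) * I) := by
    push_cast; rw [add_mul, exp_add]
  have hcc := exp_mul_conj_exp (arg (coefC r s lam))
  constructor
  · rintro ⟨hf, h⟩
    obtain ⟨k, hk, hfk, hkr, hkd⟩ := eqOn_of_iteratedDeriv_eq hs hsr hr hlam θ hf h
    rw [← hkr] at hζ ⊢
    obtain ⟨m, hm, hkm⟩ := hk.exists_factor (norm_ofReal_lt_one h0 hr) hζ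
    rw [rotatedDeriv_T h0 hr hζ hm hkm] at hkd
    have hd : ((1 - ‖k r‖ ^ 2 : ℝ) : ℂ) ≠ 0 := by
      have : 0 < 1 - ‖k r‖ ^ 2 := by nlinarith [norm_nonneg (k r)]
      exact_mod_cast this.ne'
    have hmr : m r = exp (((θ + arg (coefC r s lam) : ℝ) : ℂ) * I) := by
      have := mul_left_cancel₀ hd hkd
      rw [hexp]
      linear_combination exp (arg (coefC r s lam) * I) * this - m r * hcc
    have hmc := hm.eqOn_const hrm (by rw [hmr]; exact norm_exp_ofReal_mul_I _)
    intro z hz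
    rw [hfk hz, extremal₄_eq, schurExtension, schurExtension, hkm z hz, hmc z hz, hmr]
  · intro hf
    rw [extremal₄_eq] at hf
    have hk := isSchur_extremal₄_parameter h0 hr hζ (θ + arg (coefC r s lam))
    refine ⟨mem_classH0_of_eqOn hs hsr hr hlam hk hf, ?_⟩
    rw [iteratedDeriv_eq_of_eqOn hs hsr hr hlam hk hf,
      rotatedDeriv_T h0 hr hζ (isSchur_const (norm_exp_ofReal_mul_I _).le) fun z _ => rfl,
      T_comp_T_neg_mul_apply_self r _ fun _ => _, coefAffine, supportPoint, rad_mul, hexp]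
    congr 6
    linear_combination exp (θ * I) * hcc

lemma extremal₃_iff {r s : ℝ} (hs : 0 ≤ s) (hsr : s < r) (hr : r < 1) {lam : ℂ}
    (hlam : ‖lam‖ < 1) (θ : ℝ) (hζ : ‖zetaTheta (eta r s lam) (tpar r s lam) θ‖ = 1) (f : ℂ → ℂ) :
    (f ∈ classH0 r s lam ∧ iteratedDeriv 3 f r =
      coefAffine r s lam (supportPoint (eta r s lam) (tpar r s lam) θ)) ↔
    EqOn f (extremal₃ r s lam (zetaTheta (eta r s lam) (tpar r s lam) θ)) (ball 0 1) := by
  have h0 : 0 < r := hs.trans_lt hsr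
  have hrm := ofReal_mem_ball h0 hr
  constructor
  · rintro ⟨hf, h⟩
    obtain ⟨k, hk, hfk, hkr, -⟩ := eqOn_of_iteratedDeriv_eq hs hsr hr hlam θ hf h
    rw [← hkr] at hζ ⊢
    intro z hz
    rw [hfk hz, extremal₃_eq, schurExtension, schurExtension, hk.eqOn_const hrm hζ z hz]
  · intro hf
    rw [extremal₃_eq] at hf
    have hk := isSchur_const hζ.le
    refine ⟨mem_classH0_of_eqOn hs hsr hr hlam hk hf, ?_⟩
    rw [iteratedDeriv_eq_of_eqOn hs hsr hr hlam hk hf,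
      rotatedDeriv_of_norm_eq_one h0 hr hk hζ, supportPoint_of_norm_eq_one hζ, mul_zero, add_zero,
      coefAffine]

lemma isClosedJordanDomain_region {r s : ℝ} (hs : 0 ≤ s) (hsr : s < r) (hr : r < 1) {lam : ℂ}
    (hlam : ‖lam‖ < 1) {γ : ℝ → ℂ} (hc : Continuous γ)
    (hp : Function.Periodic γ (2 * Real.pi))
    (hb : BijOn γ (Ioc (-Real.pi) Real.pi) (frontier (region r s lam))) :
    IsClosedJordanDomain (region r s lam) := by
  have hη := norm_eta_lt hs hsr hlam
  obtain ⟨e, he⟩ := exists_homeomorph_coefAffine hs hsr hr hlam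
  have hV := region_eq_image hs hsr hr hlam
  rw [← he] at hV
  refine ⟨?_, ?_, ?_, isJordanCurve_of_periodic hc hp hb⟩
  · rw [hV]; exact (isCompact_diskUnion _ _).image e.continuous
  · rw [hV, ← e.image_interior, ← e.image_closure, closure_interior_diskUnion hη]
  · rw [hV, ← e.image_interior]
    exact ((convex_diskUnion hη).interior.isConnected (interior_diskUnion_nonempty hη)).image _
      e.continuous.continuousOn

lemma bijOn_frontier_region {r s : ℝ} (hs : 0 ≤ s) (hsr : s < r) (hr : r < 1) {lam : ℂ}
    (hlam : ‖lam‖ < 1) :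
    BijOn (fun θ => coefAffine r s lam (supportPoint (eta r s lam) (tpar r s lam) θ))
      (Ioc (-Real.pi) Real.pi) (frontier (region r s lam)) := by
  obtain ⟨e, he⟩ := exists_homeomorph_coefAffine hs hsr hr hlam
  rw [region_eq_image hs hsr hr hlam, ← he, ← e.image_frontier]
  exact (e.injective.injOn.bijOn_image).comp (bijOn_supportPoint (norm_eta_lt hs hsr hlam))

lemma le_norm_of_add_le {η : ℂ} {t : ℝ} (hη : ‖η‖ < t) (h : t + ‖η‖ ≤ 1 / 2) (θ : ℝ) :
    2 * (t ^ 2 - ‖η‖ ^ 2) ≤ ‖t * exp (θ * I) - conj η‖ := by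
  have h1 := norm_sub_norm_le (t * exp (θ * I)) (conj η)
  rw [norm_mul, norm_exp_ofReal_mul_I, norm_real, Real.norm_eq_abs,
    abs_of_pos ((norm_nonneg _).trans_lt hη), RCLike.norm_conj] at h1
  nlinarith

lemma norm_le_of_le_sub {η : ℂ} {t : ℝ} (hη : ‖η‖ < t) (h : 1 / 2 ≤ t - ‖η‖) (θ : ℝ) :
    ‖t * exp (θ * I) - conj η‖ ≤ 2 * (t ^ 2 - ‖η‖ ^ 2) := by
  have h1 := norm_sub_le (t * exp (θ * I)) (conj η)
  rw [norm_mul, norm_exp_ofReal_mul_I, norm_real, Real.norm_eq_abs,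
    abs_of_pos ((norm_nonneg _).trans_lt hη), RCLike.norm_conj] at h1
  nlinarith [norm_nonneg η]

end ThirdDieudonne

theorem theorem4p1 (r s : ℝ) (hs : 0 ≤ s) (hsr : s < r) (hr : r < 1)
    (lam : ℂ) (hlam : ‖lam‖ < 1)
    (V : Set ℂ) (hV : V = region r s lam)
    (A : ℝ) (hA : A = coefA r s) (B C : ℂ) (hB : B = coefB r s lam) (hC : C = coefC r s lam)
    (η : ℂ) (hη : η = eta r s lam) (t : ℝ) (ht : t = tpar r s lam)
    (ζ : ℝ → ℂ) (hζ : ∀ θ, ζ θ = zetaTheta η t θ) :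
    -- `V(r,s,λ)` is a convex closed domain enclosed by the Jordan curve `∂V(r,s,λ)`
    Convex ℝ V ∧ IsClosedJordanDomain V ∧
    -- `t_θ` and `ζ_θ` are well defined, and `ζ_θ` lies in the closed unit disk
    (∀ θ : ℝ, 2 * (t ^ 2 - ‖η‖ ^ 2) ≤ ‖t * exp (θ * I) - conj η‖ → ∃! x : ℝ, IsSol η θ x) ∧
    (∀ θ : ℝ, ‖ζ θ‖ ≤ 1) ∧
    -- the parametric representation of the boundary
    (∃ γ : ℝ → ℂ, Continuous γ ∧ Function.Periodic γ (2 * Real.pi) ∧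
      BijOn γ (Ioc (-Real.pi) Real.pi) (frontier V) ∧
      (t + ‖η‖ ≤ 1 / 2 → ∀ θ : ℝ,
        2 * (t ^ 2 - ‖η‖ ^ 2) ≤ ‖t * exp (θ * I) - conj η‖ ∧
        γ θ = A * (B + C * cen η (ζ θ))) ∧
      (1 / 2 ≤ t - ‖η‖ → ∀ θ : ℝ,
        ‖t * exp (θ * I) - conj η‖ ≤ 2 * (t ^ 2 - ‖η‖ ^ 2) ∧
        γ θ = A * (B + C * (cen η (ζ θ) + rad t (ζ θ) * exp (θ * I)))) ∧
      (1 / 2 < t + ‖η‖ → t - ‖η‖ < 1 / 2 → ∀ θ : ℝ,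
        (‖t * exp (θ * I) - conj η‖ < 2 * (t ^ 2 - ‖η‖ ^ 2) →
          γ θ = A * (B + C * (cen η (ζ θ) + rad t (ζ θ) * exp (θ * I)))) ∧
        (2 * (t ^ 2 - ‖η‖ ^ 2) ≤ ‖t * exp (θ * I) - conj η‖ →
          γ θ = A * (B + C * cen η (ζ θ))))) ∧
    -- the extremal functions when `ζ_θ` lies in the open disk
    (∀ θ : ℝ, ‖ζ θ‖ < 1 →
      A * (B + C * (cen η (ζ θ) + rad t (ζ θ) * exp (θ * I))) ∈ frontier V ∧
      IsBlaschkeProduct 4 (extremal₄ r s lam (ζ θ) (θ + arg C)) ∧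
      ∀ f : ℂ → ℂ,
        (f ∈ classH0 r s lam ∧
          iteratedDeriv 3 f r = A * (B + C * (cen η (ζ θ) + rad t (ζ θ) * exp (θ * I)))) ↔
        EqOn f (extremal₄ r s lam (ζ θ) (θ + arg C)) (ball 0 1)) ∧
    -- the extremal functions when `ζ_θ` lies on the unit circle
    (∀ θ : ℝ, ‖ζ θ‖ = 1 →
      A * (B + C * cen η (ζ θ)) ∈ frontier V ∧
      IsBlaschkeProduct 3 (extremal₃ r s lam (ζ θ)) ∧
      ∀ f : ℂ → ℂ,
        (f ∈ classH0 r s lam ∧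
          iteratedDeriv 3 f r = A * (B + C * cen η (ζ θ))) ↔
        EqOn f (extremal₃ r s lam (ζ θ)) (ball 0 1)) := by
  subst hV hA hB hC hη ht
  obtain rfl : ζ = zetaTheta (eta r s lam) (tpar r s lam) := funext hζ
  have hη := norm_eta_lt hs hsr hlam
  set η := eta r s lam
  set t := tpar r s lam
  have hcont : Continuous fun θ => coefAffine r s lam (supportPoint η t θ) := by
    have := continuous_supportPoint hη
    unfold coefAffine
    fun_prop
  have hper : Function.Periodic (fun θ => coefAffine r s lam (supportPoint η t θ))
      (2 * Real.pi) := fun θ => by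
    simp only [periodic_supportPoint η t θ]
  have hbij := bijOn_frontier_region hs hsr hr hlam
  have hγ : ∀ θ, ‖zetaTheta η t θ‖ = 1 → coefAffine r s lam (supportPoint η t θ) =
      coefA r s * (coefB r s lam + coefC r s lam * cen η (zetaTheta η t θ)) := fun θ h => by
    rw [supportPoint_of_norm_eq_one h, coefAffine]
  refine ⟨?_, isClosedJordanDomain_region hs hsr hr hlam hcont hper hbij, fun θ hθ => ?_,
    fun θ => (isMaximizer_zetaTheta hη θ).norm_le,
    ⟨_, hcont, hper, hbij, fun h θ => ?_, fun h θ => ⟨norm_le_of_le_sub hη h θ, rfl⟩,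
      fun _ _ θ => ⟨fun _ => rfl, fun h => hγ θ (norm_zetaTheta_of_le hη h)⟩⟩,
    fun θ hθ => ?_, fun θ hθ => ?_⟩
  · rw [region_eq_image hs hsr hr hlam]
    exact Convex.coefAffine_image (convex_diskUnion hη) r s lam
  · exact ⟨_, (tTheta_of_le hη hθ).2, fun y hy => hy.unique (tTheta_of_le hη hθ).2⟩
  · have h1 := le_norm_of_add_le hη h θ
    exact ⟨h1, hγ θ (norm_zetaTheta_of_le hη h1)⟩
  · exact ⟨supportPoint_mem_frontier_region hs hsr hr hlam θ,
      isBlaschkeProduct_extremal₄ hs hsr hr hlam hθ _, extremal₄_iff hs hsr hr hlam θ hθ⟩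
  · rw [← hγ θ hθ]
    exact ⟨supportPoint_mem_frontier_region hs hsr hr hlam θ,
      isBlaschkeProduct_extremal₃ hs hsr hr hlam hθ, extremal₃_iff hs hsr hr hlam θ hθ⟩
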